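/- **Setting.** Let $f:\mathbb R^d\to\mathbb R$ be differentiable (not necessarily convex), bounded below with $f^*=\inf f$, and well-behaved: for all $\mathbf x,\mathbf x'$, the function $t\mapsto\langle\nabla f(\mathbf x+t(\mathbf x'-\mathbf x)),\mathbf x'-\mathbf x\rangle$ is integrable on $[0,1]$ and $f(\mathbf x')-f(\mathbf x)=\int_0^1\langle\nabla f(\mathbf x+t(\mathbf x'-\mathbf x)),\mathbf x'-\mathbf x\rangle\,dt$. For $\delta>0$ define $$\|\nabla f(\mathbf x)\|_{1,\infty}^{[\delta]}=\inf_{P:\ \mathbb E_{\mathbf y\sim P}[\mathbf y]=\mathbf x}\Big\{\big\|\mathbb E_{\mathbf y\sim P}[\nabla f(\mathbf y)]\big\|_1+\delta\,\mathbb E_{\mathbf y\sim P}\big[\|\mathbf y-\mathbf x\|_\infty^2\big]\Big\},$$ the infimum being over Borel probability measures $P$ on $\mathbb R^d$ for which these expectations are finite; $\mathbf x$ is a $(\delta,\epsilon)$-$\ell_{1,\infty}$-stationary point if this quantity is at most $\epsilon$. **Algorithm** (non-smooth non-convex StoSignSGD). Inputs: $\mathbf x_0\in\mathbb R^d$, integers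 $K,N$, $D_\infty>0$, $\boldsymbol\Delta_0$ with $\|\boldsymbol\Delta_0\|_\infty\le D_\infty$, and step sizes $\eta_t$. Put $T=KN$, $\eta_0=0$, $\mathbf G_0=\mathbf 0$. For $t=1,\dots,T$: 1. compute $\boldsymbol\Delta_t\in\arg\min_{\|\mathbf z\|_\infty\le D_\infty}\sum_i G_{t-1,i}\,(z_i-v_{t,i})^2$, where $\mathbf v_t=\boldsymbol\Delta_{t-1}-\eta_{t-1}\,\mathrm{sgn}(\mathbf g_{t-1}+\mathbf G_{t-1}\odot\mathbf n_{t-1})$ and $\mathbf n_{t-1}\sim\mathrm{Unif}([-1,1]^d)$ is independent of the first $t-1$ rounds (if the minimizer is not unique, any choice made before $s_t$ is drawn is allowed); 2. draw $s_t\sim\mathrm{Exp}(1)$, independent of everything so far; 3. set $\mathbf x_t=\mathbf x_{t-1}+s_t\boldsymbol\Delta_t$; 4. query the oracle once to get an integrable $\mathbf g_t$ whose conditional expectation given everything before the query is $\nabla f(\mathbf x_t)$; 5. set $\mathbf G_t=\max\{\mathbf G_{t-1},|\mathbf g_t|\}$ coordinate-wise. Return $\overline{\mathbf x}=\overline{\mathbf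 x}^{k}$, where $\overline{\mathbf x}^k=\frac1N\sum_{n=1}^N\mathbf x_{(k-1)N+n}$ and $k$ is uniform on $\{1,\dots,K\}$, independent of the $T$ rounds. **Theorem.** Let $\epsilon,\delta>0$, $\Delta_f>0$ with $f(\mathbf x_0)-f^*\le\Delta_f$, and $\mathbf L\in\mathbb R^d$ with $L_i\ge0$, $\|\mathbf L\|_1>0$. Set $$K=\lceil a\rceil,\ a=\frac{7\sqrt{14}\,\Delta_f\delta^{1/2}}{2\epsilon^{3/2}},\qquad N=\lceil b\rceil,\ b=751\|\mathbf L\|_1^2\epsilon^{-2},\qquad D_\infty=\frac{\sqrt\epsilon}{\sqrt{14\delta}\,N},\qquad \eta_t=\frac{\sqrt2\,D_\infty}{\sqrt{((t-1)\bmod N)+1}}\ (t\ge1),$$ and run the algorithm with these parameters. Assume $\mathbb E\big[\max_{1\le t\le T}|g_{t,i}|^2\big]\le L_i^2$ for every $i$. Then $\|\nabla f(\overline{\mathbf x})\|_{1,\infty}^{[\delta]}$ is integrable and $$\mathbb E\Big[\|\nabla f(\overline{\mathbf x})\|_{1,\infty}^{[\delta]}\Big]\le\epsilon,$$ that is, in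 expectation the output is a $(\delta,\epsilon)$-$\ell_{1,\infty}$-stationary point, and the algorithm uses exactly $T=KN$ stochastic gradients. Moreover, if $a\ge\frac12$ and $b\ge\frac12$, then $$T\le 39340\,\Delta_f\|\mathbf L\|_1^2\,\delta^{1/2}\epsilon^{-7/2},$$ and if in addition $K\ge3$ or $N\ge3$, then $$T\le 39326\,\Delta_f\|\mathbf L\|_1^2\,\delta^{1/2}\epsilon^{-7/2}.$$ -/

import Mathlib

open MeasureTheory ProbabilityTheory
open scoped ENNReal

namespace StoSign

/-- `ℝ^d`. -/
abbrev Vec (d : ℕ) : Type := EuclideanSpace ℝ (Fin d)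

/-- The `ℓ_p` norm of a vector with `d` coordinates, `1 ≤ p ≤ ∞`. -/
noncomputable def vecNorm {d : ℕ} (p : ℝ≥0∞) (v : Vec d) : ℝ :=
  ‖WithLp.toLp p v.ofLp‖

/-- The closed ball `B_q(x, r)` of the `ℓ_q` norm. -/
def lqBall {d : ℕ} (q : ℝ≥0∞) (x : Vec d) (r : ℝ) : Set (Vec d) :=
  {y | vecNorm q (y - x) ≤ r}

/-! ### Assumptions on the objective -/

/-- Well-behavedness: `f` is differentiable and satisfies the fundamental theorem of calculus
along every segment (the integral being a convergent Lebesgue integral). -/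
def WellBehaved {d : ℕ} (f : Vec d → ℝ) : Prop :=
  Differentiable ℝ f ∧ ∀ x x' : Vec d,
    IntervalIntegrable (fun t : ℝ => inner ℝ (gradient f (x + t • (x' - x))) (x' - x))
      volume 0 1 ∧
    f x' - f x = ∫ t in (0 : ℝ)..1, inner ℝ (gradient f (x + t • (x' - x))) (x' - x)

/-! ### The stationarity measure -/

/-- The probability measures over which the stationarity measure is minimised: those with mean
`x` for which the two expectations in the objective are finite. -/
structure IsAdmissible {d : ℕ} (q : ℝ≥0∞) (f : Vec d → ℝ) (x : Vec d)
    (P : Measure (Vec d)) : Prop where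
  prob : IsProbabilityMeasure P
  integrable_id : Integrable (fun y : Vec d => y) P
  mean : ∫ y, y ∂P = x
  integrable_gradient : Integrable (gradient f) P
  integrable_sq : Integrable (fun y : Vec d => vecNorm q (y - x) ^ 2) P

/-- `inf { ‖E ∇f(y)‖_p + δ E ‖y - x‖_q ^ 2 : y ∼ P, E y = x }`. -/
noncomputable def stationarity {d : ℕ} (p q : ℝ≥0∞) (δ : ℝ) (f : Vec d → ℝ) (x : Vec d) : ℝ :=
  sInf {r : ℝ | ∃ P : Measure (Vec d), IsAdmissible q f x P ∧
    r = vecNorm p (∫ y, gradient f y ∂P) + δ * ∫ y, vecNorm q (y - x) ^ 2 ∂P}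

/-! ### Building blocks of the algorithm -/

/-- `‖x‖_G ^ 2 = xᵀ diag(G) x`. -/
def weightedSq {d : ℕ} (G : Fin d → ℝ) (x : Vec d) : ℝ := ∑ i, G i * x i ^ 2

/-- `y` is a `G`-weighted projection of `x` onto `X`: a point of
`argmin_{z ∈ X} ‖z - x‖_G ^ 2`.  (It is unique when all `G i > 0`; if some `G i = 0`, every
minimiser is allowed.) -/
def IsWeightedProj {d : ℕ} (G : Fin d → ℝ) (X : Set (Vec d)) (x y : Vec d) : Prop :=
  y ∈ X ∧ ∀ z ∈ X, weightedSq G (y - x) ≤ weightedSq G (z - x)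

/-- The stochastic sign `sgn(v + G ⊙ n)` with noise realisation `n`. -/
noncomputable def stoSign {d : ℕ} (G : Fin d → ℝ) (v : Vec d) (n : Fin d → ℝ) : Vec d :=
  WithLp.toLp 2 fun i => Real.sign (v i + G i * n i)

/-- The random variables generated by one execution of the algorithm on the sample space `Ω`. -/
structure Trace (d : ℕ) (Ω : Type*) where
  /-- `noise t` is the noise `n_t` of the stochastic sign -/
  noise : ℕ → Ω → Fin d → ℝ
  /-- `dir t` is the direction `Δ_t` -/
  dir : ℕ → Ω → Vec d
  /-- `scale t` is the random scaling `s_t` -/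
  scale : ℕ → Ω → ℝ
  /-- `grad t` is the stochastic gradient `g_t` -/
  grad : ℕ → Ω → Vec d
  /-- the index of the block whose average is returned -/
  index : Ω → ℕ

namespace Trace

variable {d : ℕ} {Ω : Type*}

/-- The iterates `x_{t+1} = x_t + s_{t+1} Δ_{t+1}`. -/
def iterate (R : Trace d Ω) (x₀ : Vec d) : ℕ → Ω → Vec d
  | 0, _ => x₀
  | t + 1, ω => R.iterate x₀ t ω + R.scale (t + 1) ω • R.dir (t + 1) ω

/-- The trackers `G_0 = 0`, `G_{t+1} = max {G_t, |g_{t+1}|}`. -/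
def tracker (R : Trace d Ω) : ℕ → Ω → Fin d → ℝ
  | 0, _ => 0
  | t + 1, ω => fun i => max (R.tracker t ω i) |R.grad (t + 1) ω i|

/-- The average `x̄^k` of the iterates of the `k`-th block of length `N`, `k = 1, 2, …`. -/
noncomputable def blockAverage (R : Trace d Ω) (x₀ : Vec d) (N k : ℕ) (ω : Ω) : Vec d :=
  (N : ℝ)⁻¹ • ∑ m ∈ Finset.Icc 1 N, R.iterate x₀ ((k - 1) * N + m) ω

/-- The returned point. -/
noncomputable def output (R : Trace d Ω) (x₀ : Vec d) (N : ℕ) (ω : Ω) : Vec d :=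
  R.blockAverage x₀ N (R.index ω) ω

/-- The information available at the end of round `t`: everything sampled or computed in
rounds `1, …, t`. -/
abbrev history (R : Trace d Ω) (t : ℕ) : MeasurableSpace Ω :=
  ⨆ r ∈ Finset.range t,
    MeasurableSpace.comap (R.noise r) inferInstance ⊔
    MeasurableSpace.comap (R.dir (r + 1)) inferInstance ⊔
    MeasurableSpace.comap (R.scale (r + 1)) inferInstance ⊔
    MeasurableSpace.comap (R.grad (r + 1)) inferInstance

/-- The information available in round `t + 1` once `Δ_{t+1}` has been computed. -/
abbrev historyDir (R : Trace d Ω) (t : ℕ) : MeasurableSpace Ω :=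
  R.history t ⊔ MeasurableSpace.comap (R.noise t) inferInstance ⊔
    MeasurableSpace.comap (R.dir (t + 1)) inferInstance

/-- The information available in round `t + 1` when the oracle is queried at `x_{t+1}`. -/
abbrev historyQuery (R : Trace d Ω) (t : ℕ) : MeasurableSpace Ω :=
  R.historyDir t ⊔ MeasurableSpace.comap (R.scale (t + 1)) inferInstance

/-- `R` is an execution, on the probability space `(Ω, μ)`, of non-smooth non-convex StoSignSGD
on `f` with inputs `x₀, Δ₀, K, N, D` and step sizes `η`.  Round `t + 1` is described for
every `t < K * N`; each round makes exactly one oracle call. -/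
structure IsStoSignSGD [MeasurableSpace Ω] (R : Trace d Ω) (μ : Measure Ω)
    (f : Vec d → ℝ) (x₀ Δ₀ : Vec d) (K N : ℕ) (D : ℝ) (η : ℕ → ℝ) : Prop where
  dir_zero : ∀ ω, R.dir 0 ω = Δ₀
  /-- the sign noise is fresh and uniform on the cube `[-1,1]^d` -/
  noise_measurable : ∀ t < K * N, Measurable (R.noise t)
  noise_law : ∀ t < K * N, pdf.IsUniform (R.noise t) (Set.Icc (-1) 1) μ volume
  noise_indep : ∀ t < K * N,
    Indep (MeasurableSpace.comap (R.noise t) inferInstance) (R.history t) μ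
  /-- `Δ_{t+1} = Π^{G_t}_{B_∞(0,D)} [Δ_t - η_t S_{G_t}(g_t)]` -/
  dir_measurable : ∀ t < K * N, Measurable (R.dir (t + 1))
  dir_update : ∀ t < K * N, ∀ ω,
    IsWeightedProj (R.tracker t ω) (lqBall ∞ 0 D)
      (R.dir t ω - η t • stoSign (R.tracker t ω) (R.grad t ω) (R.noise t ω))
      (R.dir (t + 1) ω)
  /-- the scaling is fresh and exponentially distributed with rate `1` -/
  scale_measurable : ∀ t < K * N, Measurable (R.scale (t + 1))
  scale_law : ∀ t < K * N, μ.map (R.scale (t + 1)) = expMeasure 1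
  scale_indep : ∀ t < K * N,
    Indep (MeasurableSpace.comap (R.scale (t + 1)) inferInstance) (R.historyDir t) μ
  /-- the oracle is unbiased, given everything that happened before it is called -/
  grad_measurable : ∀ t < K * N, Measurable (R.grad (t + 1))
  grad_integrable : ∀ t < K * N, Integrable (R.grad (t + 1)) μ
  grad_unbiased : ∀ t < K * N,
    μ[R.grad (t + 1) | R.historyQuery t] =ᵐ[μ]
      fun ω => gradient f (R.iterate x₀ (t + 1) ω)
  /-- the index of the returned block is uniform on `{1, …, K}` and independent of the rest -/
  index_measurable : Measurable R.index
  index_law : μ.map R.index = uniformOn (Set.Icc 1 K)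
  index_indep :
    Indep (MeasurableSpace.comap R.index inferInstance) (R.history (K * N)) μ

/-- Coordinate-wise Lipschitzness over `T` rounds: `E [ (max_{t ≤ T} |g_{t,i}|) ^ 2 ] ≤ L_i ^ 2`. -/
def CoordLipschitz [MeasurableSpace Ω] (R : Trace d Ω) (μ : Measure Ω) (T : ℕ)
    (L : Vec d) : Prop :=
  (∀ i, 0 ≤ L i) ∧
  ∀ i, ∫⁻ ω, (⨆ t ∈ Finset.Icc 1 T, ‖R.grad t ω i‖ₑ) ^ 2 ∂μ ≤ ENNReal.ofReal (L i ^ 2)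

end Trace

/-! ### The choice of parameters -/

/-- `7 √14 Δ_f δ^{1/2} / (2 ε^{3/2})`, which is rounded up to give `K`. -/
noncomputable def preK (Δf δ ε : ℝ) : ℝ :=
  7 * √14 * Δf * δ ^ (1 / 2 : ℝ) / (2 * ε ^ (3 / 2 : ℝ))

/-- `751 ‖L‖₁^2 ε^{-2}`, which is rounded up to give `N`. -/
noncomputable def preN {d : ℕ} (L : Vec d) (ε : ℝ) : ℝ :=
  751 * vecNorm 1 L ^ 2 * ε ^ (-2 : ℝ)

/-- The number `K` of blocks. -/
noncomputable def numBlocks (Δf δ ε : ℝ) : ℕ := ⌈preK Δf δ ε⌉₊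

/-- The block length `N`. -/
noncomputable def blockLength {d : ℕ} (L : Vec d) (ε : ℝ) : ℕ := ⌈preN L ε⌉₊

/-- `D_∞ = √ε / (√(14 δ) N)`. -/
noncomputable def radius (δ ε : ℝ) (N : ℕ) : ℝ := √ε / (√(14 * δ) * N)

/-- `η_0 = 0` and `η_t = √2 D_∞ / √(((t - 1) mod N) + 1)` for `t ≥ 1`. -/
noncomputable def stepSize (D : ℝ) (N : ℕ) : ℕ → ℝ
  | 0 => 0
  | t + 1 => √2 * D / √(((t % N : ℕ) : ℝ) + 1)

end StoSign

/-!
The proof rests on two conversions that need no smoothness of `f`.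

*Random scaling* (`WellBehaved.random_scaling`). For `s` exponential and independent of `(x, Δ)`,
integrating by parts against the density `e^{-s}` gives
`E [f (x + s Δ) - f x] = E ⟨∇ f (x + s Δ), Δ⟩`. Summed over the rounds, the expected linear losses
`E ⟨∇ f (x_t), Δ_t⟩` therefore add up to `E f (x_T) - f x₀ ≥ - Δf`.

*Online learning* (`block_bound`, `block_expectation`). Within a block of length `N` the directions
`Δ_t` are produced by projected descent on the box of radius `D`, coordinate by coordinate, against
the linear losses with gradient `h_t = G_t ⊙ sgn (g_t + G_t ⊙ n_t)` (`surrogate`). Since the noise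
is uniform, `h_t` is a conditionally unbiased estimate of `∇ f (x_t)`
(`integral_mul_sign`, `integral_mul_surrogate`) bounded by the tracker `G_t`, so that its errors are
orthogonal in `L²` and their sum over a block has mean absolute value at most `√N L_i`
(`integral_abs_noise_le`). The trackers being monotone, the regret telescopes and is at most
`5 D √N G_i`. The comparator `- D sgn (∑ ∇ f (x_t))` turns the loss of a block into
`- D ‖∑ ∇ f (x_t)‖₁`. The last round of a block is bounded trivially, because the update that
follows it is not part of the block. Adding up the blocks (`sum_integral_vecNorm_le`) gives
`D ∑_k E ‖∑_n ∇ f (x_{k,n})‖₁ ≤ Δf + 6 K D √N ‖L‖₁`.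

The stationarity measure at a block average is bounded through the uniform distribution on the `N`
iterates of the block (`stationarity_average_le`), whose distances to their mean are at most
`D ∑ s_t`. With the given parameters the three resulting terms are at most `2ε/7`, `2ε/9` and `ε/7`
(`parameter_bound`), which is below `ε`.

Integrability of the stationarity measure at the output requires its measurability as a function of
the point. The gradient of `f` need not even be locally bounded, but the stationarity measure is
upper semicontinuous (`upperSemicontinuous_stationarity`).

The bounds on `K N` follow from `⌈a⌉ ≤ 2 a` for `a ≥ 1/2`, and `⌈a⌉ ≤ 3 a / 2` if `⌈a⌉ ≥ 3`.
-/

namespace StoSign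

/-! ### The exponential distribution -/

theorem expMeasure_one_eq : expMeasure 1 =
    (volume.restrict (Set.Ioi (0 : ℝ))).withDensity fun s => ENNReal.ofReal (Real.exp (-s)) := by
  have h1 : expMeasure 1 = volume.withDensity (exponentialPDF 1) := rfl
  rw [h1, ← withDensity_indicator measurableSet_Ioi]
  refine withDensity_congr_ae ?_
  have h0 : ∀ᵐ s : ℝ, s ≠ 0 := by simp [ae_iff]
  filter_upwards [h0] with s hs
  rcases lt_or_gt_of_ne hs with h | h
  · rw [exponentialPDF_of_neg h, Set.indicator_of_notMem (by simp [h.le])]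
  · rw [exponentialPDF_of_nonneg h.le, Set.indicator_of_mem (by simpa using h)]
    simp

theorem integral_expMeasure_one (g : ℝ → ℝ) :
    ∫ s, g s ∂(expMeasure 1) = ∫ s in Set.Ioi 0, Real.exp (-s) * g s := by
  rw [expMeasure_one_eq, integral_withDensity_eq_integral_toReal_smul (by fun_prop) (by simp)]
  simp [ENNReal.toReal_ofReal (Real.exp_pos _).le]

theorem integrable_expMeasure_one_iff {g : ℝ → ℝ} :
    Integrable g (expMeasure 1) ↔ IntegrableOn (fun s => Real.exp (-s) * g s) (Set.Ioi 0) := by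
  rw [expMeasure_one_eq, integrable_withDensity_iff_integrable_smul' (by fun_prop) (by simp)]
  simp [ENNReal.toReal_ofReal (Real.exp_pos _).le, IntegrableOn]

theorem ae_expMeasure_one_pos : ∀ᵐ s ∂(expMeasure 1), 0 < s := by
  rw [expMeasure_one_eq]
  exact (withDensity_absolutelyContinuous _ _).ae_le (ae_restrict_mem measurableSet_Ioi)

theorem integrable_sq_expMeasure_one : Integrable (fun s : ℝ => s ^ 2) (expMeasure 1) := by
  rw [integrable_expMeasure_one_iff]
  have h := Real.GammaIntegral_convergent (s := 3) (by norm_num)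
  refine h.congr_fun (fun s _ => ?_) measurableSet_Ioi
  have h3 : s ^ ((3 : ℝ) - 1) = s ^ 2 := by
    rw [← Real.rpow_natCast]; norm_num
  simp only [h3]

theorem integral_sq_expMeasure_one : ∫ s, s ^ 2 ∂(expMeasure 1) = 2 := by
  rw [integral_expMeasure_one]
  have h := Real.Gamma_eq_integral (s := 3) (by norm_num)
  have h2 : Real.Gamma 3 = 2 := by
    have h3 := Real.Gamma_nat_eq_factorial 2
    rw [show ((2 : ℕ) : ℝ) + 1 = 3 by norm_num] at h3
    rw [h3]; norm_num [Nat.factorial]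
  rw [← h2, h]
  refine setIntegral_congr_fun measurableSet_Ioi (fun s _ => ?_)
  have h3 : s ^ ((3 : ℝ) - 1) = s ^ 2 := by
    rw [← Real.rpow_natCast]; norm_num
  simp only [h3]

/-- Integration by parts against the exponential density: both sides are the integral of
`e^{-s} h r` over `0 < r < s`, evaluated in the two orders. -/
theorem integrable_integral_primitive_expMeasure_one {h : ℝ → ℝ} (hm : Measurable h)
    (hi : Integrable h (expMeasure 1)) :
    Integrable (fun s => ∫ r in Set.Ioo 0 s, h r) (expMeasure 1) ∧
      ∫ s, (∫ r in Set.Ioo 0 s, h r) ∂(expMeasure 1) = ∫ s, h s ∂(expMeasure 1) := by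
  rw [integrable_expMeasure_one_iff] at hi
  set F : ℝ × ℝ → ℝ := Set.indicator {p : ℝ × ℝ | p.2 < p.1} fun p => Real.exp (-p.1) * h p.2
    with hF
  have hFm : Measurable F := by
    refine Measurable.indicator (by fun_prop) (measurableSet_lt measurable_snd measurable_fst)
  -- the inner integral over the larger variable
  have inner_int (r : ℝ) (c : ℝ) (hr : 0 < r) :
      Integrable (fun s => Set.indicator (Set.Ioi r) (fun s => Real.exp (-s) * c) s)
        (volume.restrict (Set.Ioi 0)) ∧
      ∫ s in Set.Ioi 0, Set.indicator (Set.Ioi r) (fun s => Real.exp (-s) * c) s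
        = Real.exp (-r) * c := by
    have hsub : Set.Ioi (0 : ℝ) ∩ Set.Ioi r = Set.Ioi r := by
      ext s; simp only [Set.mem_inter_iff, Set.mem_Ioi]; constructor
      · exact fun h => h.2
      · exact fun h => ⟨hr.trans h, h⟩
    constructor
    · rw [integrable_indicator_iff measurableSet_Ioi, IntegrableOn,
        Measure.restrict_restrict measurableSet_Ioi, Set.inter_comm, hsub]
      exact (integrableOn_exp_neg_Ioi r).mul_const c
    · rw [setIntegral_indicator measurableSet_Ioi, hsub, integral_mul_const, integral_exp_neg_Ioi]
  have hFr (r s : ℝ) : F (s, r) = Set.indicator (Set.Ioi r) (fun s => Real.exp (-s) * h r) s := by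
    simp [hF, Set.indicator_apply]
  have hFr' (r s : ℝ) :
      ‖F (s, r)‖ = Set.indicator (Set.Ioi r) (fun s => Real.exp (-s) * |h r|) s := by
    rw [hFr, Set.indicator_apply, Set.indicator_apply]
    split_ifs <;> simp
  have hFi : Integrable F ((volume.restrict (Set.Ioi 0)).prod (volume.restrict (Set.Ioi 0))) := by
    rw [integrable_prod_iff' hFm.aestronglyMeasurable]
    constructor
    · filter_upwards [ae_restrict_mem measurableSet_Ioi] with r hr
      simp_rw [hFr]
      exact (inner_int r (h r) hr).1
    · refine (IntegrableOn.congr_fun hi.norm (fun r hr => ?_) measurableSet_Ioi)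
      simp_rw [hFr']
      rw [(inner_int r |h r| hr).2]
      simp
  have hsr (s : ℝ) : ∫ r in Set.Ioi 0, F (s, r) = Real.exp (-s) * ∫ r in Set.Ioo 0 s, h r := by
    have : (fun r => F (s, r)) = Set.indicator (Set.Iio s) (fun r => Real.exp (-s) * h r) := by
      ext r; simp [hF, Set.indicator_apply]
    rw [this, setIntegral_indicator measurableSet_Iio, Set.Ioi_inter_Iio, integral_const_mul]
  constructor
  · rw [integrable_expMeasure_one_iff]
    simpa only [hsr, IntegrableOn] using hFi.integral_prod_left
  · have hsw := integral_integral_swap (f := fun s r => F (s, r)) hFi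
    simp only [hsr] at hsw
    rw [integral_expMeasure_one, integral_expMeasure_one, hsw]
    refine setIntegral_congr_fun measurableSet_Ioi (fun r hr => ?_)
    simp only [hFr]
    exact (inner_int r (h r) hr).2

theorem integral_abs_primitive_expMeasure_one_le {h : ℝ → ℝ} (hm : Measurable h)
    (hi : Integrable h (expMeasure 1)) :
    ∫ s, |∫ r in Set.Ioo 0 s, h r| ∂(expMeasure 1) ≤ ∫ s, |h s| ∂(expMeasure 1) := by
  have h1 := integrable_integral_primitive_expMeasure_one hm.abs hi.abs
  rw [← h1.2]
  refine integral_mono (integrable_integral_primitive_expMeasure_one hm hi).1.abs h1.1 fun s => ?_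
  exact abs_integral_le_integral_abs

/-! ### Random scaling -/

section RandomScaling

variable {d : ℕ} {f : Vec d → ℝ}

theorem measurable_gradient (f : Vec d → ℝ) : Measurable (gradient f) := by
  unfold gradient
  exact (InnerProductSpace.toDual ℝ (Vec d)).symm.continuous.measurable.comp
    (measurable_fderiv ℝ f)

theorem WellBehaved.continuous (hf : WellBehaved f) : Continuous f := hf.1.continuous

/-- The fundamental theorem of calculus along a ray. -/
theorem WellBehaved.sub_eq_integral (hf : WellBehaved f) (x Δ : Vec d) {s : ℝ} (hs : 0 < s) :
    f (x + s • Δ) - f x = ∫ r in Set.Ioo 0 s, inner ℝ (gradient f (x + r • Δ)) Δ := by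
  have h := (hf.2 x (x + s • Δ)).2
  simp only [add_sub_cancel_left, inner_smul_right, smul_smul] at h
  rw [h]
  have h2 := intervalIntegral.mul_integral_comp_mul_right
    (f := fun r => inner ℝ (gradient f (x + r • Δ)) Δ) (c := s) (a := 0) (b := 1)
  rw [intervalIntegral.integral_const_mul, h2, zero_mul, one_mul,
    intervalIntegral.integral_of_le hs.le, integral_Ioc_eq_integral_Ioo]

/-- Along a ray, an exponentially distributed step `s` satisfies
`E [f (x + s Δ) - f x] = E ⟨∇ f (x + s Δ), Δ⟩`. -/
theorem WellBehaved.expMeasure_ray (hf : WellBehaved f) (x Δ : Vec d)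
    (hi : Integrable (fun s : ℝ => inner ℝ (gradient f (x + s • Δ)) Δ) (expMeasure 1)) :
    Integrable (fun s : ℝ => f (x + s • Δ) - f x) (expMeasure 1) ∧
    ∫ s, (f (x + s • Δ) - f x) ∂(expMeasure 1)
      = ∫ s, inner ℝ (gradient f (x + s • Δ)) Δ ∂(expMeasure 1) ∧
    ∫ s, |f (x + s • Δ) - f x| ∂(expMeasure 1)
      ≤ ∫ s, |inner ℝ (gradient f (x + s • Δ)) Δ| ∂(expMeasure 1) := by
  have hm : Measurable fun s : ℝ => inner ℝ (gradient f (x + s • Δ)) Δ :=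
    ((measurable_gradient f).comp (by fun_prop)).inner measurable_const
  have hae : (fun s : ℝ => ∫ r in Set.Ioo 0 s, inner ℝ (gradient f (x + r • Δ)) Δ)
      =ᵐ[expMeasure 1] fun s : ℝ => f (x + s • Δ) - f x := by
    filter_upwards [ae_expMeasure_one_pos] with s hs
    exact (hf.sub_eq_integral x Δ hs).symm
  have h1 := integrable_integral_primitive_expMeasure_one hm hi
  have h2 := integral_abs_primitive_expMeasure_one_le hm hi
  refine ⟨h1.1.congr hae, ?_, ?_⟩
  · rw [← h1.2]; exact integral_congr_ae hae.symm
  · refine le_trans (le_of_eq (integral_congr_ae ?_)) h2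
    filter_upwards [hae] with s hs
    rw [hs]

/-- Random scaling: if `s` is exponentially distributed and independent of `(X, Δ)`, then the
expected change of `f` from `X` to `X + s Δ` is *exactly* the expected linearization at the new
point, without any smoothness of `f`. -/
theorem WellBehaved.random_scaling (hf : WellBehaved f) {Ω : Type*} [MeasurableSpace Ω]
    {μ : Measure Ω} [IsProbabilityMeasure μ] {X Δ : Ω → Vec d} {s : Ω → ℝ}
    (hX : Measurable X) (hΔ : Measurable Δ) (hs : Measurable s)
    (hlaw : μ.map s = expMeasure 1) (hind : IndepFun (fun ω => (X ω, Δ ω)) s μ)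
    (hi : Integrable (fun ω => inner ℝ (gradient f (X ω + s ω • Δ ω)) (Δ ω)) μ) :
    Integrable (fun ω => f (X ω + s ω • Δ ω) - f (X ω)) μ ∧
    ∫ ω, (f (X ω + s ω • Δ ω) - f (X ω)) ∂μ
      = ∫ ω, inner ℝ (gradient f (X ω + s ω • Δ ω)) (Δ ω) ∂μ := by
  have hXΔ : Measurable fun ω => (X ω, Δ ω) := hX.prodMk hΔ
  have hpair : Measurable fun ω => ((X ω, Δ ω), s ω) := hXΔ.prodMk hs
  have hmap : μ.map (fun ω => ((X ω, Δ ω), s ω)) =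
      (μ.map fun ω => (X ω, Δ ω)).prod (expMeasure 1) := by
    rw [(indepFun_iff_map_prod_eq_prod_map_map hXΔ.aemeasurable hs.aemeasurable).1 hind, hlaw]
  have : IsProbabilityMeasure (μ.map fun ω => (X ω, Δ ω)) :=
    Measure.isProbabilityMeasure_map hXΔ.aemeasurable
  have : IsProbabilityMeasure (expMeasure 1) := isProbabilityMeasure_expMeasure one_pos
  set ν := μ.map fun ω => (X ω, Δ ω)
  set A : (Vec d × Vec d) × ℝ → ℝ := fun p => inner ℝ (gradient f (p.1.1 + p.2 • p.1.2)) p.1.2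
    with hA
  set B : (Vec d × Vec d) × ℝ → ℝ := fun p => f (p.1.1 + p.2 • p.1.2) - f p.1.1 with hB
  have hAm : Measurable A :=
    ((measurable_gradient f).comp (by fun_prop)).inner (by fun_prop)
  have hBm : Measurable B := by
    have := hf.continuous
    exact Continuous.measurable (by fun_prop)
  have hAi : Integrable A (ν.prod (expMeasure 1)) := by
    rw [← hmap, integrable_map_measure hAm.aestronglyMeasurable hpair.aemeasurable]
    exact hi
  have hray : ∀ᵐ p ∂ν, Integrable (fun r => A (p, r)) (expMeasure 1) := hAi.prod_right_ae
  have hBi : Integrable B (ν.prod (expMeasure 1)) := by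
    rw [integrable_prod_iff hBm.aestronglyMeasurable]
    constructor
    · filter_upwards [hray] with p hp
      exact (hf.expMeasure_ray p.1 p.2 hp).1
    · refine hAi.integral_norm_prod_left.mono'
        hBm.norm.aestronglyMeasurable.integral_prod_right' ?_
      filter_upwards [hray] with p hp
      rw [Real.norm_of_nonneg (integral_nonneg fun _ => norm_nonneg _)]
      exact (hf.expMeasure_ray p.1 p.2 hp).2.2
  have hBΩ : Integrable (fun ω => f (X ω + s ω • Δ ω) - f (X ω)) μ := by
    have : Integrable B (μ.map (fun ω => ((X ω, Δ ω), s ω))) := by rw [hmap]; exact hBi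
    exact (integrable_map_measure hBm.aestronglyMeasurable hpair.aemeasurable).1 this
  refine ⟨hBΩ, ?_⟩
  calc ∫ ω, (f (X ω + s ω • Δ ω) - f (X ω)) ∂μ
      = ∫ p, B p ∂(ν.prod (expMeasure 1)) := by
        rw [← hmap, integral_map hpair.aemeasurable hBm.aestronglyMeasurable]
    _ = ∫ p, ∫ r, B (p, r) ∂(expMeasure 1) ∂ν := integral_prod _ hBi
    _ = ∫ p, ∫ r, A (p, r) ∂(expMeasure 1) ∂ν := by
        refine integral_congr_ae ?_
        filter_upwards [hray] with p hp
        exact (hf.expMeasure_ray p.1 p.2 hp).2.1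
    _ = ∫ p, A p ∂(ν.prod (expMeasure 1)) := (integral_prod _ hAi).symm
    _ = _ := by rw [← hmap, integral_map hpair.aemeasurable hAm.aestronglyMeasurable]

end RandomScaling

/-! ### Coordinates and `ℓ_p` norms -/

section Norms

variable {d : ℕ}

theorem vecNorm_nonneg (p : ℝ≥0∞) [Fact (1 ≤ p)] (v : Vec d) : 0 ≤ vecNorm p v :=
  norm_nonneg _

theorem vecNorm_zero (p : ℝ≥0∞) [Fact (1 ≤ p)] : vecNorm p (0 : Vec d) = 0 := by
  simp [vecNorm]

theorem vecNorm_add_le (p : ℝ≥0∞) [Fact (1 ≤ p)] (v w : Vec d) :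
    vecNorm p (v + w) ≤ vecNorm p v + vecNorm p w := by
  simpa [vecNorm] using norm_add_le (WithLp.toLp p v.ofLp) (WithLp.toLp p w.ofLp)

theorem vecNorm_smul (p : ℝ≥0∞) [Fact (1 ≤ p)] (c : ℝ) (v : Vec d) :
    vecNorm p (c • v) = |c| * vecNorm p v := by
  simpa [vecNorm] using norm_smul c (WithLp.toLp p v.ofLp)

@[fun_prop]
theorem continuous_vecNorm (p : ℝ≥0∞) [Fact (1 ≤ p)] :
    Continuous (vecNorm p : Vec d → ℝ) :=
  ((PiLp.continuous_toLp p _).comp (PiLp.continuous_ofLp 2 _)).norm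

theorem vecNorm_one_eq (v : Vec d) : vecNorm 1 v = ∑ i, |v i| := by
  simp [vecNorm, PiLp.norm_eq_of_L1]

theorem vecNorm_top_eq (v : Vec d) : vecNorm ∞ v = ‖v.ofLp‖ := by
  simp [vecNorm]

theorem vecNorm_top_le_iff {v : Vec d} {r : ℝ} (hr : 0 ≤ r) :
    vecNorm ∞ v ≤ r ↔ ∀ i, |v i| ≤ r := by
  rw [vecNorm_top_eq]; exact pi_norm_le_iff_of_nonneg hr

end Norms

/-! ### The stationarity measure -/

section Stationarity

variable {d : ℕ} {p q : ℝ≥0∞} {f : Vec d → ℝ} {δ : ℝ}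

theorem isAdmissible_dirac (x : Vec d) : IsAdmissible q f x (Measure.dirac x) where
  prob := inferInstance
  integrable_id := integrable_dirac (by simp)
  mean := by simp
  integrable_gradient := integrable_dirac (by simp)
  integrable_sq := integrable_dirac (by simp)

theorem exists_isAdmissible_lt {x : Vec d} {r : ℝ}
    (h : stationarity p q δ f x < r) : ∃ P : Measure (Vec d), IsAdmissible q f x P ∧
      vecNorm p (∫ y, gradient f y ∂P) + δ * ∫ y, vecNorm q (y - x) ^ 2 ∂P < r := by
  have hne : {r : ℝ | ∃ P : Measure (Vec d), IsAdmissible q f x P ∧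
      r = vecNorm p (∫ y, gradient f y ∂P) + δ * ∫ y, vecNorm q (y - x) ^ 2 ∂P}.Nonempty :=
    ⟨_, Measure.dirac x, isAdmissible_dirac x, rfl⟩
  obtain ⟨_, ⟨P, hP, rfl⟩, hlt⟩ := exists_lt_of_csInf_lt hne h
  exact ⟨P, hP, hlt⟩

variable [Fact (1 ≤ p)]

theorem stationarity_le (hδ : 0 ≤ δ) {x : Vec d} {P : Measure (Vec d)}
    (hP : IsAdmissible q f x P) :
    stationarity p q δ f x ≤
      vecNorm p (∫ y, gradient f y ∂P) + δ * ∫ y, vecNorm q (y - x) ^ 2 ∂P := by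
  refine csInf_le ⟨0, ?_⟩ ⟨P, hP, rfl⟩
  rintro r ⟨P', -, rfl⟩
  exact add_nonneg (vecNorm_nonneg p _)
    (mul_nonneg hδ (integral_nonneg fun _ => sq_nonneg _))

theorem stationarity_nonneg (hδ : 0 ≤ δ) (x : Vec d) : 0 ≤ stationarity p q δ f x := by
  refine Real.sInf_nonneg ?_
  rintro r ⟨P', -, rfl⟩
  exact add_nonneg (vecNorm_nonneg p _)
    (mul_nonneg hδ (integral_nonneg fun _ => sq_nonneg _))

/-- The mixture of `P` with weight `w₀` and of the point masses at `z i` with weights `w i`. -/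
noncomputable def mixture {ι : Type*} [Fintype ι] (P : Measure (Vec d)) (w₀ : ℝ) (w : ι → ℝ)
    (z : ι → Vec d) : Measure (Vec d) :=
  ENNReal.ofReal w₀ • P + ∑ i, ENNReal.ofReal (w i) • Measure.dirac (z i)

section Mixture

variable {ι : Type*} [Fintype ι] {P : Measure (Vec d)} {w₀ : ℝ} {w : ι → ℝ} {z : ι → Vec d}

theorem integrable_mixture {E : Type*} [NormedAddCommGroup E] {g : Vec d → E}
    (hg : Integrable g P) : Integrable g (mixture P w₀ w z) := by
  refine (hg.smul_measure ENNReal.ofReal_ne_top).add_measure ?_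
  exact integrable_finsetSum_measure.2 fun i _ =>
    (integrable_dirac (by simp)).smul_measure ENNReal.ofReal_ne_top

theorem integral_mixture {E : Type*} [NormedAddCommGroup E] [NormedSpace ℝ E] [CompleteSpace E]
    {g : Vec d → E} (hg : Integrable g P) (h₀ : 0 ≤ w₀) (hw : ∀ i, 0 ≤ w i) :
    ∫ y, g y ∂(mixture P w₀ w z) = w₀ • ∫ y, g y ∂P + ∑ i, w i • g (z i) := by
  have hd : ∀ i ∈ Finset.univ, Integrable g (ENNReal.ofReal (w i) • Measure.dirac (z i)) :=
    fun i _ => (integrable_dirac (by simp)).smul_measure ENNReal.ofReal_ne_top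
  rw [mixture, integral_add_measure (hg.smul_measure ENNReal.ofReal_ne_top)
    (integrable_finsetSum_measure.2 hd), integral_finsetSum_measure hd, integral_smul_measure,
    ENNReal.toReal_ofReal h₀]
  congr 1
  refine Finset.sum_congr rfl fun i _ => ?_
  rw [integral_smul_measure, ENNReal.toReal_ofReal (hw i), integral_dirac]

theorem isProbabilityMeasure_mixture [IsProbabilityMeasure P] (h₀ : 0 ≤ w₀) (hw : ∀ i, 0 ≤ w i)
    (hsum : w₀ + ∑ i, w i = 1) : IsProbabilityMeasure (mixture P w₀ w z) := by
  refine ⟨?_⟩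
  simp only [mixture, Measure.add_apply, Measure.smul_apply, Measure.finsetSum_apply,
    measure_univ, smul_eq_mul, mul_one]
  rw [← ENNReal.ofReal_sum_of_nonneg fun i _ => hw i,
    ← ENNReal.ofReal_add h₀ (Finset.sum_nonneg fun i _ => hw i), hsum, ENNReal.ofReal_one]

/-- The square of a sum, bounded without a term linear in `a`, so that its expectation is controlled
by the second moment of `a` alone. -/
theorem add_sq_le (a ρ : ℝ) (hρ : 0 ≤ ρ) : (a + ρ) ^ 2 ≤ (1 + ρ) * a ^ 2 + (ρ + ρ ^ 2) := by
  nlinarith [mul_nonneg hρ (sq_nonneg (a - 1))]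

variable [Fact (1 ≤ q)]

theorem vecNorm_sub_sq_le (x x' y : Vec d) :
    vecNorm q (y - x') ^ 2 ≤ (1 + vecNorm q (x - x')) * vecNorm q (y - x) ^ 2 +
      (vecNorm q (x - x') + vecNorm q (x - x') ^ 2) := by
  refine le_trans ?_ (add_sq_le _ _ (vecNorm_nonneg q _))
  refine pow_le_pow_left₀ (vecNorm_nonneg q _) ?_ 2
  simpa using vecNorm_add_le q (y - x) (x - x')

/-- A mixture of an admissible measure at `x` with finitely many point masses is admissible at its
mean `x'`, so that it bounds the stationarity measure at `x'`. -/
theorem stationarity_le_mixture (hδ : 0 ≤ δ) {x x' : Vec d} (hP : IsAdmissible q f x P)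
    (h₀ : 0 ≤ w₀) (hw : ∀ i, 0 ≤ w i) (hsum : w₀ + ∑ i, w i = 1)
    (hmean : w₀ • x + ∑ i, w i • z i = x') :
    stationarity p q δ f x' ≤
      vecNorm p (w₀ • ∫ y, gradient f y ∂P + ∑ i, w i • gradient f (z i)) +
      δ * (w₀ * ((1 + vecNorm q (x - x')) * ∫ y, vecNorm q (y - x) ^ 2 ∂P +
        (vecNorm q (x - x') + vecNorm q (x - x') ^ 2)) +
        ∑ i, w i * vecNorm q (z i - x') ^ 2) := by
  have := hP.prob
  have hdom : Integrable (fun y : Vec d => (1 + vecNorm q (x - x')) * vecNorm q (y - x) ^ 2 +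
      (vecNorm q (x - x') + vecNorm q (x - x') ^ 2)) P :=
    (hP.integrable_sq.const_mul _).add (integrable_const _)
  have hsq : Integrable (fun y : Vec d => vecNorm q (y - x') ^ 2) P := by
    refine hdom.mono' (Continuous.aestronglyMeasurable (by fun_prop)) (ae_of_all _ fun y => ?_)
    rw [Real.norm_of_nonneg (sq_nonneg _)]
    exact vecNorm_sub_sq_le x x' y
  have hQ : IsAdmissible q f x' (mixture P w₀ w z) :=
    { prob := isProbabilityMeasure_mixture h₀ hw hsum
      integrable_id := integrable_mixture hP.integrable_id
      mean := by rw [integral_mixture hP.integrable_id h₀ hw, hP.mean, hmean]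
      integrable_gradient := integrable_mixture hP.integrable_gradient
      integrable_sq := integrable_mixture hsq }
  refine (stationarity_le (p := p) hδ hQ).trans ?_
  rw [integral_mixture hP.integrable_gradient h₀ hw, integral_mixture hsq h₀ hw]
  simp only [smul_eq_mul]
  gcongr
  refine (integral_mono hsq hdom fun y => vecNorm_sub_sq_le x x' y).trans (le_of_eq ?_)
  rw [integral_add (hP.integrable_sq.const_mul _) (integrable_const _), integral_const_mul]
  simp

end Mixture

variable [Fact (1 ≤ q)]

/-- The stationarity measure is upper semicontinuous, although `∇ f` may be discontinuous: a
nearly optimal measure at `x` becomes admissible at a nearby `x'` once it is mixed with small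
multiples of the point masses at `x ± e_i`, and only these finitely many gradients enter. -/
theorem upperSemicontinuous_stationarity (hδ : 0 ≤ δ) :
    UpperSemicontinuous (stationarity p q δ f) := by
  intro x r hr
  obtain ⟨P, hP, hlt⟩ := exists_isAdmissible_lt hr
  -- the weights of `x ± e_i` are the positive and negative parts of the coordinates of `x' - x`
  set w : Vec d → Fin d ⊕ Fin d → ℝ := fun x' =>
    Sum.elim (fun i => max ((x' - x) i) 0) (fun i => max (-(x' - x) i) 0) with hwdef
  set z : Fin d ⊕ Fin d → Vec d :=
    Sum.elim (fun i => x + EuclideanSpace.single i 1) (fun i => x - EuclideanSpace.single i 1)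
    with hz
  -- the bound of `stationarity_le_mixture`, continuous in `x'`
  set U : Vec d → ℝ := fun x' =>
    vecNorm p ((1 - ∑ j, w x' j) • ∫ y, gradient f y ∂P + ∑ j, w x' j • gradient f (z j)) +
      δ * ((1 - ∑ j, w x' j) * ((1 + vecNorm q (x - x')) * ∫ y, vecNorm q (y - x) ^ 2 ∂P +
        (vecNorm q (x - x') + vecNorm q (x - x') ^ 2)) +
        ∑ j, w x' j * vecNorm q (z j - x') ^ 2) with hU
  have hwc : ∀ j, Continuous fun x' => w x' j := by
    rintro (i | i) <;> simp only [hwdef, Sum.elim_inl, Sum.elim_inr] <;> fun_prop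
  have hUc : Continuous U := by fun_prop
  have hw0 : ∀ j, w x j = 0 := by
    rintro (i | i) <;> simp [hwdef]
  have hUx : U x < r := by
    simpa [hU, hw0, vecNorm_zero] using hlt
  have hW : ∀ᶠ x' in nhds x, ∑ j, w x' j < 1 := by
    have hc : Continuous fun x' => ∑ j, w x' j := by fun_prop
    refine hc.continuousAt.eventually_lt_const ?_
    simp [hw0]
  filter_upwards [hUc.continuousAt.eventually_lt_const hUx, hW] with x' h1 h2
  refine lt_of_le_of_lt ?_ h1
  refine stationarity_le_mixture hδ hP (by linarith) ?_ (by ring) ?_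
  · rintro (i | i) <;> simp [hwdef]
  · have key : ∀ i, max ((x' - x) i) 0 - max (-(x' - x) i) 0 = (x' - x) i := by
      intro i
      rcases le_total 0 ((x' - x) i) with h | h
      · rw [max_eq_left h, max_eq_right (by linarith)]; ring
      · rw [max_eq_right h, max_eq_left (by linarith)]; ring
    have hs : ∑ j, w x' j • z j = (∑ j, w x' j) • x + (x' - x) := by
      have hb : ∑ i, (max ((x' - x) i) 0 - max (-(x' - x) i) 0) • EuclideanSpace.single i (1 : ℝ)
          = x' - x := by
        ext k
        simp only [key]
        simp [Finset.sum_apply, Pi.single_apply]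
      rw [← hb]
      simp only [Fintype.sum_sum_type, hwdef, hz, Sum.elim_inl, Sum.elim_inr, smul_add, smul_sub,
        sub_smul, add_smul, Finset.sum_add_distrib, Finset.sum_sub_distrib, Finset.sum_smul]
      abel
    rw [hs, sub_smul, one_smul]
    abel

theorem measurable_stationarity (hδ : 0 ≤ δ) : Measurable (stationarity p q δ f) :=
  (upperSemicontinuous_stationarity hδ).measurable

/-- The stationarity measure at the average of `N` points is bounded through the uniform
distribution on these points. -/
theorem stationarity_average_le (hδ : 0 ≤ δ) {N : ℕ} (hN : 0 < N) (y : ℕ → Vec d) {x : Vec d}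
    (hx : x = (N : ℝ)⁻¹ • ∑ m ∈ Finset.Icc 1 N, y m) :
    stationarity p q δ f x ≤
      (N : ℝ)⁻¹ * vecNorm p (∑ m ∈ Finset.Icc 1 N, gradient f (y m)) +
      δ * ((N : ℝ)⁻¹ * ∑ m ∈ Finset.Icc 1 N, vecNorm q (y m - x) ^ 2) := by
  have hN' : (N : ℝ) ≠ 0 := by positivity
  have h := stationarity_le_mixture (p := p) (q := q) (f := f) (δ := δ) (w₀ := 0)
    (w := fun _ : Finset.Icc 1 N => (N : ℝ)⁻¹) (z := fun m => y m) hδ (isAdmissible_dirac x)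
    le_rfl (fun _ => by positivity) (by simp [hN']) (x' := x) (by
      rw [zero_smul, zero_add, ← Finset.smul_sum, hx]
      congr 1
      exact Finset.sum_coe_sort (Finset.Icc 1 N) y)
  rw [zero_smul, zero_add, zero_mul, zero_add, ← Finset.smul_sum, ← Finset.mul_sum,
    Finset.sum_coe_sort (Finset.Icc 1 N) (fun m => gradient f (y m)),
    Finset.sum_coe_sort (Finset.Icc 1 N) (fun m => vecNorm q (y m - x) ^ 2), vecNorm_smul,
    abs_of_nonneg (by positivity)] at h
  exact h

end Stationarity

/-! ### Weighted projections onto a box and the regret of one block -/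

section Regret

theorem mem_lqBall_top_zero_iff {d : ℕ} {D : ℝ} (hD : 0 ≤ D) {y : Vec d} :
    y ∈ lqBall ∞ 0 D ↔ ∀ i, |y i| ≤ D := by
  simp only [lqBall, Set.mem_ofPred_eq, sub_zero]
  exact vecNorm_top_le_iff hD

/-- A weighted projection onto a box clips every coordinate of positive weight, so it brings such
a coordinate closer to every point of the box. -/
theorem IsWeightedProj.mul_sub_sq_le {d : ℕ} {D : ℝ} (hD : 0 ≤ D) {G : Fin d → ℝ} {x y : Vec d}
    (h : IsWeightedProj G (lqBall ∞ 0 D) x y) {i : Fin d} (hG : 0 ≤ G i) {u : ℝ} (hu : |u| ≤ D) :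
    G i * (y i - u) ^ 2 ≤ G i * (x i - u) ^ 2 := by
  have hy := (mem_lqBall_top_zero_iff hD).1 h.1
  have hmin : ∀ c : ℝ, |c| ≤ D → G i * (y i - x i) ^ 2 ≤ G i * (c - x i) ^ 2 := by
    intro c hc
    have hz : WithLp.toLp 2 (Function.update y.ofLp i c) ∈ lqBall ∞ (0 : Vec d) D := by
      rw [mem_lqBall_top_zero_iff hD]
      intro j
      by_cases hj : j = i
      · subst hj; simpa using hc
      · simpa [Function.update_of_ne hj] using hy j
    have h2 := h.2 _ hz
    rw [weightedSq, weightedSq, ← Finset.add_sum_erase _ _ (Finset.mem_univ i),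
      ← Finset.add_sum_erase _ _ (Finset.mem_univ i)] at h2
    have h3 : ∑ j ∈ Finset.univ.erase i,
        G j * (WithLp.toLp 2 (Function.update y.ofLp i c) - x : Vec d) j ^ 2 =
        ∑ j ∈ Finset.univ.erase i, G j * (y - x) j ^ 2 := by
      refine Finset.sum_congr rfl fun j hj => ?_
      simp [Function.update_of_ne (Finset.ne_of_mem_erase hj)]
    rw [h3] at h2
    simpa only [PiLp.sub_apply, Function.update_self] using le_of_add_le_add_right h2
  rcases hG.eq_or_lt with h0 | h0
  · simp [← h0]
  · refine mul_le_mul_of_nonneg_left ?_ hG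
    have hmin' : ∀ c : ℝ, |c| ≤ D → |y i - x i| ≤ |c - x i| := fun c hc =>
      sq_le_sq.1 (le_of_mul_le_mul_left (hmin c hc) h0)
    have hyi := abs_le.1 (hy i)
    have hu' := abs_le.1 hu
    rw [sq_le_sq]
    rcases lt_or_ge D (x i) with hx | hx
    · have h1 := hmin' D (abs_of_nonneg hD).le
      rw [abs_of_nonpos (by linarith), abs_of_nonpos (by linarith)] at h1
      rw [abs_of_nonneg (by linarith), abs_of_nonneg (by linarith)]
      linarith
    · rcases lt_or_ge (x i) (-D) with hx' | hx'
      · have h1 := hmin' (-D) (by rw [abs_neg, abs_of_nonneg hD])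
        rw [abs_of_nonneg (by linarith), abs_of_nonneg (by linarith)] at h1
        rw [abs_of_nonpos (by linarith), abs_of_nonpos (by linarith)]
        linarith
      · have h1 := hmin' (x i) (abs_le.2 ⟨hx', hx⟩)
        rw [sub_self, abs_zero] at h1
        rw [sub_eq_zero.1 (abs_eq_zero.1 (le_antisymm h1 (abs_nonneg _)))]

/-- One step of projected descent with step size `√2 D / √n`. -/
theorem step_regret {D n G σ x x' u : ℝ} (hD : 0 < D) (hn : 0 < n) (hG : 0 ≤ G) (hσ : σ ^ 2 ≤ 1)
    (hupd : G * (x' - u) ^ 2 ≤ G * (x - √2 * D / √n * σ - u) ^ 2) :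
    G * σ * (x - u) ≤ G * √n / (2 * √2 * D) * ((x - u) ^ 2 - (x' - u) ^ 2)
      + √2 * D * (G / (2 * √n)) := by
  have hs : 0 < √n := Real.sqrt_pos.2 hn
  have h2 : 0 < √2 := Real.sqrt_pos.2 two_pos
  set η := √2 * D / √n with hη
  have hηp : 0 < η := by positivity
  have e1 : G * √n / (2 * √2 * D) = G / (2 * η) := by rw [hη]; field_simp
  have e2 : √2 * D * (G / (2 * √n)) = η * G / 2 := by rw [hη]; field_simp
  rw [e1, e2]
  have h3 : 2 * η * (G * σ * (x - u)) ≤ G * ((x - u) ^ 2 - (x' - u) ^ 2) + η ^ 2 * G := by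
    have := mul_le_mul_of_nonneg_left hσ (mul_nonneg (sq_nonneg η) hG)
    nlinarith
  have h4 : G / (2 * η) * ((x - u) ^ 2 - (x' - u) ^ 2) + η * G / 2
      = (G * ((x - u) ^ 2 - (x' - u) ^ 2) + η ^ 2 * G) / (2 * η) := by field_simp
  rw [h4, le_div_iff₀ (by positivity)]
  linarith

theorem sqrt_add_inv_le {m : ℝ} (hm : 0 ≤ m) : √m + 1 / (2 * √(m + 1)) ≤ √(m + 1) := by
  have h1 : 0 < √(m + 1) := Real.sqrt_pos.2 (by linarith)
  have h2 := Real.sq_sqrt hm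
  have h3 := Real.sq_sqrt (show 0 ≤ m + 1 by linarith)
  have h4 : 1 / (2 * √(m + 1)) ≤ √(m + 1) - √m := by
    rw [div_le_iff₀ (by positivity)]
    nlinarith [sq_nonneg (√(m + 1) - √m)]
  linarith

variable {N : ℕ} {D : ℝ} {G σ x h : ℕ → ℝ}

/-- Regret of the first `m` rounds of a block, against a fixed comparator `u`. The bound
telescopes because the weights `G n √n` are nondecreasing. -/
theorem partial_regret (hD : 0 < D) (hG0 : ∀ n, 0 ≤ G n)
    (hG : ∀ n, 1 ≤ n → n < N → G n ≤ G (n + 1)) (hσ : ∀ n, σ n ^ 2 ≤ 1)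
    (hx : ∀ n, 1 ≤ n → n ≤ N → |x n| ≤ D) {u : ℝ} (hu : |u| ≤ D)
    (hupd : ∀ n, 1 ≤ n → n < N →
      G n * (x (n + 1) - u) ^ 2 ≤ G n * (x n - √2 * D / √n * σ n - u) ^ 2) (m : ℕ) (hm : m < N) :
    ∑ n ∈ Finset.Icc 1 m, G n * σ n * (x n - u) ≤
      G m * √m / (2 * √2 * D) * (4 * D ^ 2 - (x (m + 1) - u) ^ 2) + √2 * D * (G m * √m) := by
  induction m with
  | zero => simp
  | succ m ih =>
    have ih := ih (by omega)
    rw [Finset.sum_Icc_succ_top (by omega)]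
    have hs := step_regret hD (n := ((m + 1 : ℕ) : ℝ)) (by positivity) (hG0 (m + 1)) (hσ (m + 1))
      (hupd (m + 1) (by omega) hm)
    have hGm : G m * √m ≤ G (m + 1) * √m := by
      rcases Nat.eq_zero_or_pos m with rfl | hpos
      · simp
      · exact mul_le_mul_of_nonneg_right (hG m hpos (by omega)) (Real.sqrt_nonneg _)
    have hsq : √(m : ℝ) + 1 / (2 * √((m + 1 : ℕ) : ℝ)) ≤ √((m + 1 : ℕ) : ℝ) := by
      push_cast
      exact sqrt_add_inv_le (Nat.cast_nonneg m)
    have hsq' : √(m : ℝ) ≤ √((m + 1 : ℕ) : ℝ) := Real.sqrt_le_sqrt (by push_cast; linarith)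
    have hGm' : G m * √m ≤ G (m + 1) * √((m + 1 : ℕ) : ℝ) :=
      hGm.trans (mul_le_mul_of_nonneg_left hsq' (hG0 _))
    have hd : 0 ≤ 4 * D ^ 2 - (x (m + 1) - u) ^ 2 := by
      have h1 : |x (m + 1) - u| ≤ 2 * D :=
        (abs_sub _ _).trans (by linarith [hx (m + 1) (by omega) hm.le])
      have := sq_le_sq' (by linarith [abs_le.1 h1]) (abs_le.1 h1).2
      linarith
    have ha : G m * √m / (2 * √2 * D) * (4 * D ^ 2 - (x (m + 1) - u) ^ 2) ≤
        G (m + 1) * √((m + 1 : ℕ) : ℝ) / (2 * √2 * D) * (4 * D ^ 2 - (x (m + 1) - u) ^ 2) := by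
      gcongr
    have hb : √2 * D * (G m * √m) + √2 * D * (G (m + 1) / (2 * √((m + 1 : ℕ) : ℝ))) ≤
        √2 * D * (G (m + 1) * √((m + 1 : ℕ) : ℝ)) := by
      rw [← mul_add]
      gcongr
      calc G m * √m + G (m + 1) / (2 * √((m + 1 : ℕ) : ℝ))
          ≤ G (m + 1) * √m + G (m + 1) / (2 * √((m + 1 : ℕ) : ℝ)) := by gcongr
        _ = G (m + 1) * (√m + 1 / (2 * √((m + 1 : ℕ) : ℝ))) := by ring
        _ ≤ _ := mul_le_mul_of_nonneg_left hsq (hG0 _)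
    linarith

/-- Regret of a block of `N` rounds in one coordinate. The last round of the block is not followed
by an update inside the block and is bounded trivially; it contributes `2` to the constant, and the
first `N - 1` rounds contribute `2 √2 ≤ 3`. -/
theorem block_regret (hN : 1 ≤ N) (hD : 0 < D) (hG0 : ∀ n, 0 ≤ G n)
    (hG : ∀ n, 1 ≤ n → n < N → G n ≤ G (n + 1)) (hσ : ∀ n, σ n ^ 2 ≤ 1)
    (hx : ∀ n, 1 ≤ n → n ≤ N → |x n| ≤ D) {u : ℝ} (hu : |u| ≤ D)
    (hupd : ∀ n, 1 ≤ n → n < N →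
      G n * (x (n + 1) - u) ^ 2 ≤ G n * (x n - √2 * D / √n * σ n - u) ^ 2)
    (hh : ∀ n, 1 ≤ n → n < N → h n = G n * σ n) (hhN : |h N| ≤ G N) :
    ∑ n ∈ Finset.Icc 1 N, h n * (x n - u) ≤ 5 * D * √N * G N := by
  obtain ⟨m, rfl⟩ : ∃ m, N = m + 1 := ⟨N - 1, by omega⟩
  have hp := partial_regret hD hG0 hG hσ hx hu hupd m (by omega)
  have hc : ∑ n ∈ Finset.Icc 1 m, h n * (x n - u) = ∑ n ∈ Finset.Icc 1 m, G n * σ n * (x n - u) :=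
    Finset.sum_congr rfl fun n hn => by
      rw [Finset.mem_Icc] at hn
      rw [hh n hn.1 (by omega)]
  rw [Finset.sum_Icc_succ_top (by omega), hc]
  have h2 : 0 < √2 := Real.sqrt_pos.2 two_pos
  have h22 := Real.sq_sqrt (show (0 : ℝ) ≤ 2 by norm_num)
  have hlast : h (m + 1) * (x (m + 1) - u) ≤ G (m + 1) * (2 * D) := by
    have h1 : |x (m + 1) - u| ≤ 2 * D :=
      (abs_sub _ _).trans (by linarith [hx (m + 1) (by omega) le_rfl])
    calc h (m + 1) * (x (m + 1) - u) ≤ |h (m + 1)| * |x (m + 1) - u| := by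
          rw [← abs_mul]; exact le_abs_self _
      _ ≤ _ := mul_le_mul hhN h1 (abs_nonneg _) (hG0 _)
  have hGm : G m * √m ≤ G (m + 1) * √((m + 1 : ℕ) : ℝ) := by
    rcases Nat.eq_zero_or_pos m with rfl | hpos
    · have := hG0 1
      simpa using this
    · exact mul_le_mul (hG m hpos (by omega)) (Real.sqrt_le_sqrt (by push_cast; linarith))
        (Real.sqrt_nonneg _) (hG0 _)
  have hone : G (m + 1) * 1 ≤ G (m + 1) * √((m + 1 : ℕ) : ℝ) := by
    refine mul_le_mul_of_nonneg_left ?_ (hG0 _)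
    rw [Real.one_le_sqrt]
    push_cast
    linarith [(Nat.cast_nonneg m : (0 : ℝ) ≤ m)]
  have ha : G m * √m / (2 * √2 * D) * (4 * D ^ 2 - (x (m + 1) - u) ^ 2) ≤
      √2 * D * (G m * √m) := by
    have hnn : 0 ≤ G m * √m := mul_nonneg (hG0 _) (Real.sqrt_nonneg _)
    calc G m * √m / (2 * √2 * D) * (4 * D ^ 2 - (x (m + 1) - u) ^ 2)
        ≤ G m * √m / (2 * √2 * D) * (4 * D ^ 2) := by
          gcongr
          linarith [sq_nonneg (x (m + 1) - u)]
      _ = √2 * D * (G m * √m) := by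
          rw [div_mul_eq_mul_div, div_eq_iff (by positivity)]
          linear_combination (-2) * D ^ 2 * (G m * √m) * h22
  have hs2 : √2 ≤ 3 / 2 := by
    rw [Real.sqrt_le_left (by norm_num)]; norm_num
  have hnn : 0 ≤ G (m + 1) * √((m + 1 : ℕ) : ℝ) := mul_nonneg (hG0 _) (Real.sqrt_nonneg _)
  calc _ ≤ √2 * D * (G m * √m) + √2 * D * (G m * √m) + G (m + 1) * (2 * D) := by linarith
    _ ≤ 3 / 2 * D * (G (m + 1) * √((m + 1 : ℕ) : ℝ)) + 3 / 2 * D * (G (m + 1) * √((m + 1 : ℕ) : ℝ))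
        + 2 * D * (G (m + 1) * √((m + 1 : ℕ) : ℝ)) := by
        have h5 : √2 * D * (G m * √m) ≤ 3 / 2 * D * (G (m + 1) * √((m + 1 : ℕ) : ℝ)) := by
          have := mul_nonneg (hG0 m) (Real.sqrt_nonneg m)
          gcongr
        have h6 : G (m + 1) * (2 * D) ≤ 2 * D * (G (m + 1) * √((m + 1 : ℕ) : ℝ)) := by
          calc _ = 2 * D * (G (m + 1) * 1) := by ring
            _ ≤ _ := mul_le_mul_of_nonneg_left hone (by positivity)
        linarith
    _ = _ := by ring

/-- The regret against the comparator `- D sgn (∑ a n)`, which turns the linear loss of the block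
into the absolute value of the sum of the true gradients `a n`, up to the noise `h n - a n`. -/
theorem block_bound (hN : 1 ≤ N) (hD : 0 < D) (hG0 : ∀ n, 0 ≤ G n)
    (hG : ∀ n, 1 ≤ n → n < N → G n ≤ G (n + 1)) (hσ : ∀ n, σ n ^ 2 ≤ 1)
    (hx : ∀ n, 1 ≤ n → n ≤ N → |x n| ≤ D)
    (hupd : ∀ u, |u| ≤ D → ∀ n, 1 ≤ n → n < N →
      G n * (x (n + 1) - u) ^ 2 ≤ G n * (x n - √2 * D / √n * σ n - u) ^ 2)
    (hh : ∀ n, 1 ≤ n → n < N → h n = G n * σ n) (hhN : |h N| ≤ G N) (a : ℕ → ℝ) :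
    ∑ n ∈ Finset.Icc 1 N, h n * x n + D * |∑ n ∈ Finset.Icc 1 N, a n| ≤
      5 * D * √N * G N + D * |∑ n ∈ Finset.Icc 1 N, (h n - a n)| := by
  obtain ⟨u, hu, hua⟩ : ∃ u, |u| ≤ D ∧
      u * ∑ n ∈ Finset.Icc 1 N, a n = - (D * |∑ n ∈ Finset.Icc 1 N, a n|) := by
    rcases le_total 0 (∑ n ∈ Finset.Icc 1 N, a n) with h0 | h0
    · exact ⟨-D, by rw [abs_neg, abs_of_pos hD], by rw [abs_of_nonneg h0]; ring⟩
    · exact ⟨D, by rw [abs_of_pos hD], by rw [abs_of_nonpos h0]; ring⟩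
  have hr := block_regret hN hD hG0 hG hσ hx hu (hupd u hu) hh hhN
  have hsplit : ∑ n ∈ Finset.Icc 1 N, h n * (x n - u) = ∑ n ∈ Finset.Icc 1 N, h n * x n
      - u * ∑ n ∈ Finset.Icc 1 N, (h n - a n) - u * ∑ n ∈ Finset.Icc 1 N, a n := by
    rw [Finset.mul_sum, Finset.mul_sum, ← Finset.sum_sub_distrib, ← Finset.sum_sub_distrib]
    exact Finset.sum_congr rfl fun n _ => by ring
  have hn : u * ∑ n ∈ Finset.Icc 1 N, (h n - a n) ≤ D * |∑ n ∈ Finset.Icc 1 N, (h n - a n)| :=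
    (le_abs_self _).trans (by rw [abs_mul]; exact mul_le_mul_of_nonneg_right hu (abs_nonneg _))
  linarith

end Regret

/-! ### Unbiasedness of the stochastic sign -/

section Sign

theorem measurable_sign : Measurable Real.sign := by
  have : Real.sign = fun r : ℝ => if r < 0 then -1 else if 0 < r then 1 else 0 := by
    ext r; rw [Real.sign]
  rw [this]
  exact Measurable.ite measurableSet_Iio measurable_const
    (Measurable.ite measurableSet_Ioi measurable_const measurable_const)

theorem abs_sign_le_one (r : ℝ) : |Real.sign r| ≤ 1 := by
  rcases Real.sign_apply_eq r with h | h | h <;> simp [h]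

theorem integral_sign_add_mul {g G : ℝ} (h : |g| ≤ G) :
    ∫ y in (-1 : ℝ)..1, G * Real.sign (g + G * y) = 2 * g := by
  rcases ((abs_nonneg g).trans h).eq_or_lt with h0 | h0
  · rw [← h0] at h
    simp [← h0, abs_nonpos_iff.1 h]
  have hg := abs_le.1 h
  have ha1 : -1 ≤ -g / G := by rw [le_div_iff₀ h0]; linarith
  have ha2 : -g / G ≤ 1 := by rw [div_le_iff₀ h0]; linarith
  have hm : Measurable fun y => G * Real.sign (g + G * y) :=
    (measurable_sign.comp (by fun_prop)).const_mul G
  have hi : ∀ a b : ℝ, IntervalIntegrable (fun y => G * Real.sign (g + G * y)) volume a b := by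
    intro a b
    refine (intervalIntegrable_const (c := G)).mono_fun' hm.aestronglyMeasurable
      (ae_of_all _ fun y => ?_)
    simp only [norm_mul, Real.norm_of_nonneg h0.le]
    exact mul_le_of_le_one_right h0.le (abs_sign_le_one _)
  rw [← intervalIntegral.integral_add_adjacent_intervals (hi (-1) (-g / G)) (hi (-g / G) 1)]
  have i1 : ∫ y in (-1 : ℝ)..(-g / G), G * Real.sign (g + G * y) =
      ∫ _ in (-1 : ℝ)..(-g / G), -G := by
    rw [intervalIntegral.integral_of_le ha1, intervalIntegral.integral_of_le ha1,
      integral_Ioc_eq_integral_Ioo, integral_Ioc_eq_integral_Ioo]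
    refine setIntegral_congr_fun measurableSet_Ioo fun y hy => ?_
    have := (lt_div_iff₀ h0).1 hy.2
    rw [Real.sign_of_neg (by linarith)]
    ring
  have i2 : ∫ y in (-g / G)..1, G * Real.sign (g + G * y) = ∫ _ in (-g / G)..(1 : ℝ), G := by
    rw [intervalIntegral.integral_of_le ha2, intervalIntegral.integral_of_le ha2]
    refine setIntegral_congr_fun measurableSet_Ioc fun y hy => ?_
    have := (div_lt_iff₀ h0).1 hy.1
    rw [Real.sign_of_pos (by linarith)]
    ring
  rw [i1, i2, intervalIntegral.integral_const, intervalIntegral.integral_const]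
  simp only [smul_eq_mul]
  field_simp
  ring

theorem cond_Icc_eq : (volume : Measure ℝ)[|Set.Icc (-1) 1] =
    (2 : ℝ≥0∞)⁻¹ • volume.restrict (Set.Icc (-1) 1) := by
  rw [ProbabilityTheory.cond, Real.volume_Icc]
  norm_num

theorem integral_cond_sign {g G : ℝ} (h : |g| ≤ G) :
    ∫ y, G * Real.sign (g + G * y) ∂((volume : Measure ℝ)[|Set.Icc (-1) 1]) = g := by
  rw [cond_Icc_eq, integral_smul_measure, integral_Icc_eq_integral_Ioc,
    ← intervalIntegral.integral_of_le (by norm_num), integral_sign_add_mul h]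
  simp

/-- The coordinates of a uniform point of the cube `[-1,1]^d` are uniform on `[-1,1]`. -/
theorem map_apply_uniform_cube {d : ℕ} {Ω : Type*} [MeasurableSpace Ω] {μ : Measure Ω}
    {n : Ω → Fin d → ℝ} (hn : Measurable n)
    (hu : pdf.IsUniform n (Set.Icc (-1) 1) μ volume) (i : Fin d) :
    μ.map (fun ω => n ω i) = (volume : Measure ℝ)[|Set.Icc (-1) 1] := by
  have h1 : μ.map (fun ω => n ω i) = (μ.map n).map (fun v => v i) := by
    rw [Measure.map_map (measurable_pi_apply i) hn]; rfl
  have hcube : (Set.Icc (-1) 1 : Set (Fin d → ℝ)) = Set.univ.pi fun _ => Set.Icc (-1 : ℝ) 1 := by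
    rw [Set.pi_univ_Icc]; rfl
  have h2 : μ.map n = (volume : Measure (Fin d → ℝ))[|Set.Icc (-1) 1] := hu
  ext A hA
  rw [h1, h2, Measure.map_apply (measurable_pi_apply i) hA,
    cond_apply measurableSet_Icc, cond_apply measurableSet_Icc]
  have hinter : (Set.Icc (-1) 1 ∩ (fun v : Fin d → ℝ => v i) ⁻¹' A) =
      Set.univ.pi (Function.update (fun _ => Set.Icc (-1 : ℝ) 1) i (Set.Icc (-1) 1 ∩ A)) := by
    rw [hcube]
    ext v
    simp only [Set.mem_inter_iff, Set.mem_pi, Set.mem_univ, true_imp_iff, Set.mem_preimage]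
    constructor
    · rintro ⟨hv, hvA⟩ j
      by_cases hj : j = i
      · subst hj; simpa using ⟨hv j, hvA⟩
      · simpa [Function.update_of_ne hj] using hv j
    · intro hv
      have hvi := hv i
      rw [Function.update_self] at hvi
      refine ⟨fun j => ?_, hvi.2⟩
      by_cases hj : j = i
      · subst hj; exact hvi.1
      · simpa [Function.update_of_ne hj] using hv j
  rw [hinter, hcube, volume_pi_pi, volume_pi_pi, ← Finset.mul_prod_erase _ _ (Finset.mem_univ i),
    ← Finset.mul_prod_erase _ _ (Finset.mem_univ i), Function.update_self]
  have hprod : ∏ j ∈ Finset.univ.erase i,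
      volume (Function.update (fun _ => Set.Icc (-1 : ℝ) 1) i (Set.Icc (-1) 1 ∩ A) j) =
      ∏ j ∈ Finset.univ.erase i, volume (Set.Icc (-1 : ℝ) 1) :=
    Finset.prod_congr rfl fun j hj => by rw [Function.update_of_ne (Finset.ne_of_mem_erase hj)]
  rw [hprod, Real.volume_Icc, Finset.prod_const]
  have hne : (ENNReal.ofReal (1 - -1)) ^ (Finset.univ.erase i).card ≠ 0 := by
    norm_num
  have hnt : (ENNReal.ofReal (1 - -1)) ^ (Finset.univ.erase i).card ≠ ∞ :=
    ENNReal.pow_ne_top ENNReal.ofReal_ne_top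
  rw [ENNReal.mul_inv (Or.inr hnt) (Or.inr hne)]
  rw [mul_assoc, mul_comm (volume _), ← mul_assoc (_ ^ _)⁻¹, ENNReal.inv_mul_cancel hne hnt,
    one_mul]

/-- The stochastic sign scaled by the tracker is unbiased: multiplied by any past variable `Z`,
`G sgn (g + G n)` has the same mean as `g` if the noise `n` is independent of the past. -/
theorem integral_mul_sign {Ω : Type*} {m mΩ : MeasurableSpace Ω} {μ : Measure Ω}
    [IsProbabilityMeasure μ] (hm : m ≤ mΩ) {Z g G n : Ω → ℝ} (hZ : Measurable[m] Z)
    (hg : Measurable[m] g) (hG : Measurable[m] G) (hn : Measurable n)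
    (hlaw : μ.map n = (volume : Measure ℝ)[|Set.Icc (-1) 1])
    (hind : Indep (MeasurableSpace.comap n inferInstance) m μ)
    (hgG : ∀ ω, |g ω| ≤ G ω) (hi : Integrable (fun ω => Z ω * G ω) μ) :
    ∫ ω, Z ω * (G ω * Real.sign (g ω + G ω * n ω)) ∂μ = ∫ ω, Z ω * g ω ∂μ := by
  have hX : Measurable[m] fun ω => (Z ω, g ω, G ω) := hZ.prodMk (hg.prodMk hG)
  have hX' : Measurable fun ω => (Z ω, g ω, G ω) := hX.mono hm le_rfl
  have hind' : IndepFun (fun ω => (Z ω, g ω, G ω)) n μ :=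
    indep_of_indep_of_le_left hind.symm hX.comap_le
  have hmap := (indepFun_iff_map_prod_eq_prod_map_map hX'.aemeasurable hn.aemeasurable).1 hind'
  rw [hlaw] at hmap
  have : IsProbabilityMeasure (μ.map fun ω => (Z ω, g ω, G ω)) :=
    Measure.isProbabilityMeasure_map hX'.aemeasurable
  set ν := μ.map fun ω => (Z ω, g ω, G ω)
  set F : (ℝ × ℝ × ℝ) × ℝ → ℝ :=
    fun p => p.1.1 * (p.1.2.2 * Real.sign (p.1.2.1 + p.1.2.2 * p.2)) with hF
  have hFm : Measurable F := by
    have := measurable_sign.comp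
      (show Measurable fun p : (ℝ × ℝ × ℝ) × ℝ => p.1.2.1 + p.1.2.2 * p.2 by fun_prop)
    exact Measurable.mul (by fun_prop) (Measurable.mul (by fun_prop) this)
  have hpair : Measurable fun ω => ((Z ω, g ω, G ω), n ω) := hX'.prodMk hn
  have hFi : Integrable F (ν.prod ((volume : Measure ℝ)[|Set.Icc (-1) 1])) := by
    rw [← hmap, integrable_map_measure hFm.aestronglyMeasurable hpair.aemeasurable]
    refine hi.norm.mono' (hFm.comp hpair).aestronglyMeasurable (ae_of_all _ fun ω => ?_)
    simp only [hF, Function.comp, norm_mul, ← mul_assoc]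
    exact mul_le_of_le_one_right (by positivity) (abs_sign_le_one _)
  have hae : ∀ᵐ p ∂ν, |p.2.1| ≤ p.2.2 := by
    refine (ae_map_iff hX'.aemeasurable ?_).2 (ae_of_all _ hgG)
    exact measurableSet_le (by fun_prop) (by fun_prop)
  calc ∫ ω, Z ω * (G ω * Real.sign (g ω + G ω * n ω)) ∂μ
      = ∫ p, F p ∂(ν.prod ((volume : Measure ℝ)[|Set.Icc (-1) 1])) := by
        rw [← hmap, integral_map hpair.aemeasurable hFm.aestronglyMeasurable]
    _ = ∫ p, ∫ y, F (p, y) ∂((volume : Measure ℝ)[|Set.Icc (-1) 1]) ∂ν := integral_prod _ hFi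
    _ = ∫ p, p.1 * p.2.1 ∂ν := by
        refine integral_congr_ae ?_
        filter_upwards [hae] with p hp
        simp only [hF]
        rw [integral_const_mul, integral_cond_sign hp]
    _ = _ := by
        rw [integral_map hX'.aemeasurable (Measurable.aestronglyMeasurable (by fun_prop))]

end Sign

/-! ### Second moments of sums of orthogonal variables -/

section Orthogonal

variable {Ω : Type*} [MeasurableSpace Ω] {μ : Measure Ω}

theorem integral_abs_le_sqrt [IsProbabilityMeasure μ] {X : Ω → ℝ} (hX : MemLp X 2 μ) :
    ∫ ω, |X ω| ∂μ ≤ √(∫ ω, X ω ^ 2 ∂μ) := by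
  refine Real.le_sqrt_of_sq_le ?_
  have h1 := variance_eq_sub hX.abs
  have h2 := variance_nonneg |X| μ
  have h3 : ∫ ω, (|X| ^ 2) ω ∂μ = ∫ ω, X ω ^ 2 ∂μ := by simp
  have h4 : ∫ ω, |X| ω ∂μ = ∫ ω, |X ω| ∂μ := by simp
  rw [h3, h4] at h1
  linarith

/-- Pythagoras: the second moment of a sum of pairwise orthogonal variables. -/
theorem memLp_sum_and_integral_sq_le {m : ℕ → Ω → ℝ} {N : ℕ} {C : ℝ}
    (hm : ∀ n ∈ Finset.Icc 1 N, MemLp (m n) 2 μ)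
    (hC : ∀ n ∈ Finset.Icc 1 N, ∫ ω, m n ω ^ 2 ∂μ ≤ C)
    (horth : ∀ n n', 1 ≤ n → n < n' → n' ≤ N → ∫ ω, m n ω * m n' ω ∂μ = 0) :
    MemLp (fun ω => ∑ n ∈ Finset.Icc 1 N, m n ω) 2 μ ∧
      ∫ ω, (∑ n ∈ Finset.Icc 1 N, m n ω) ^ 2 ∂μ ≤ N * C := by
  refine ⟨memLp_finsetSum _ hm, ?_⟩
  induction N with
  | zero => simp
  | succ N ih =>
    have hsub : ∀ n ∈ Finset.Icc 1 N, n ∈ Finset.Icc 1 (N + 1) := fun n hn => by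
      rw [Finset.mem_Icc] at hn ⊢; omega
    have hlast : N + 1 ∈ Finset.Icc 1 (N + 1) := by simp
    have ih := ih (fun n hn => hm n (hsub n hn)) (fun n hn => hC n (hsub n hn))
      (fun n n' h1 h2 h3 => horth n n' h1 h2 (by omega))
    have hS : MemLp (fun ω => ∑ n ∈ Finset.Icc 1 N, m n ω) 2 μ :=
      memLp_finsetSum _ fun n hn => hm n (hsub n hn)
    have hcross : ∫ ω, (∑ n ∈ Finset.Icc 1 N, m n ω) * m (N + 1) ω ∂μ = 0 := by
      simp only [Finset.sum_mul]
      have hi : ∀ n ∈ Finset.Icc 1 N, Integrable (fun ω => m n ω * m (N + 1) ω) μ :=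
        fun n hn => (hm n (hsub n hn)).integrable_mul (hm _ hlast)
      rw [integral_finsetSum _ hi]
      refine Finset.sum_eq_zero fun n hn => ?_
      rw [Finset.mem_Icc] at hn
      exact horth n (N + 1) hn.1 (by omega) le_rfl
    have e : ∀ ω, (∑ n ∈ Finset.Icc 1 (N + 1), m n ω) ^ 2 =
        (∑ n ∈ Finset.Icc 1 N, m n ω) ^ 2 + 2 * ((∑ n ∈ Finset.Icc 1 N, m n ω) * m (N + 1) ω)
          + m (N + 1) ω ^ 2 := fun ω => by
      rw [Finset.sum_Icc_succ_top (by omega)]; ring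
    simp only [e]
    have i1 := hS.integrable_sq
    have i2 : Integrable (fun ω => 2 * ((∑ n ∈ Finset.Icc 1 N, m n ω) * m (N + 1) ω)) μ :=
      (hS.integrable_mul (hm _ hlast)).const_mul 2
    have i12 : Integrable (fun ω => (∑ n ∈ Finset.Icc 1 N, m n ω) ^ 2 +
        2 * ((∑ n ∈ Finset.Icc 1 N, m n ω) * m (N + 1) ω)) μ := i1.add i2
    rw [integral_add i12 (hm _ hlast).integrable_sq, integral_add i1 i2,
      integral_const_mul, hcross]
    have := hC _ hlast
    push_cast
    linarith

theorem integral_abs_sum_le [IsProbabilityMeasure μ] {m : ℕ → Ω → ℝ} {N : ℕ} {C : ℝ} (hC0 : 0 ≤ C)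
    (hm : ∀ n ∈ Finset.Icc 1 N, MemLp (m n) 2 μ)
    (hC : ∀ n ∈ Finset.Icc 1 N, ∫ ω, m n ω ^ 2 ∂μ ≤ C ^ 2)
    (horth : ∀ n n', 1 ≤ n → n < n' → n' ≤ N → ∫ ω, m n ω * m n' ω ∂μ = 0) :
    ∫ ω, |∑ n ∈ Finset.Icc 1 N, m n ω| ∂μ ≤ √N * C := by
  obtain ⟨h1, h2⟩ := memLp_sum_and_integral_sq_le hm hC horth
  refine (integral_abs_le_sqrt h1).trans ((Real.sqrt_le_sqrt h2).trans (le_of_eq ?_))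
  rw [Real.sqrt_mul (Nat.cast_nonneg N), Real.sqrt_sq hC0]

end Orthogonal

namespace Trace

variable {d : ℕ} {Ω : Type*}

/-! ### Filtrations of an execution -/

section Filtration

variable (R : Trace d Ω)

theorem history_mono {s t : ℕ} (h : s ≤ t) : R.history s ≤ R.history t :=
  biSup_mono fun _ hr => Finset.mem_range.2 ((Finset.mem_range.1 hr).trans_le h)

theorem round_le_history {r t : ℕ} (h : r < t) :
    MeasurableSpace.comap (R.noise r) inferInstance ⊔
    MeasurableSpace.comap (R.dir (r + 1)) inferInstance ⊔
    MeasurableSpace.comap (R.scale (r + 1)) inferInstance ⊔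
    MeasurableSpace.comap (R.grad (r + 1)) inferInstance ≤ R.history t :=
  le_biSup (fun r => MeasurableSpace.comap (R.noise r) inferInstance ⊔
    MeasurableSpace.comap (R.dir (r + 1)) inferInstance ⊔
    MeasurableSpace.comap (R.scale (r + 1)) inferInstance ⊔
    MeasurableSpace.comap (R.grad (r + 1)) inferInstance) (Finset.mem_range.2 h)

theorem measurable_noise_history {r t : ℕ} (h : r < t) : Measurable[R.history t] (R.noise r) :=
  measurable_iff_comap_le.2
    ((le_sup_left.trans (le_sup_left.trans le_sup_left)).trans (R.round_le_history h))

theorem measurable_dir_history {r t : ℕ} (h : r < t) :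
    Measurable[R.history t] (R.dir (r + 1)) :=
  measurable_iff_comap_le.2
    ((le_sup_right.trans (le_sup_left.trans le_sup_left)).trans (R.round_le_history h))

theorem measurable_scale_history {r t : ℕ} (h : r < t) :
    Measurable[R.history t] (R.scale (r + 1)) :=
  measurable_iff_comap_le.2 ((le_sup_right.trans le_sup_left).trans (R.round_le_history h))

theorem measurable_grad_history {r t : ℕ} (h : r < t) :
    Measurable[R.history t] (R.grad (r + 1)) :=
  measurable_iff_comap_le.2 (le_sup_right.trans (R.round_le_history h))

theorem measurable_iterate_history (x₀ : Vec d) (t : ℕ) :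
    Measurable[R.history t] (R.iterate x₀ t) := by
  induction t with
  | zero => exact measurable_const
  | succ t ih =>
    have h1 := ih.mono (R.history_mono t.le_succ) le_rfl
    have h2 := R.measurable_scale_history t.lt_succ_self
    have h3 := R.measurable_dir_history t.lt_succ_self
    exact (show Measurable fun p : Vec d × ℝ × Vec d => p.1 + p.2.1 • p.2.2 by fun_prop).comp
      (h1.prodMk (h2.prodMk h3))

theorem measurable_tracker_history (t : ℕ) (i : Fin d) :
    Measurable[R.history t] (fun ω => R.tracker t ω i) := by
  induction t with
  | zero => exact measurable_const
  | succ t ih =>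
    have h1 := ih.mono (R.history_mono t.le_succ) le_rfl
    have h2 : Measurable[R.history (t + 1)] fun ω => R.grad (t + 1) ω i :=
      (show Measurable fun v : Vec d => v i by fun_prop).comp
        (R.measurable_grad_history t.lt_succ_self)
    exact h1.max ((show Measurable fun r : ℝ => |r| by fun_prop).comp h2)

theorem history_le_historyQuery (t : ℕ) : R.history t ≤ R.historyQuery t :=
  le_sup_left.trans (le_sup_left.trans le_sup_left)

theorem historyDir_le_historyQuery (t : ℕ) : R.historyDir t ≤ R.historyQuery t := le_sup_left

theorem historyQuery_le_history (t : ℕ) : R.historyQuery t ≤ R.history (t + 1) :=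
  sup_le (sup_le (sup_le (R.history_mono t.le_succ)
    (R.measurable_noise_history t.lt_succ_self).comap_le)
    (R.measurable_dir_history t.lt_succ_self).comap_le)
    (R.measurable_scale_history t.lt_succ_self).comap_le

theorem measurable_noise_historyQuery {r t : ℕ} (h : r ≤ t) :
    Measurable[R.historyQuery t] (R.noise r) := by
  rcases h.eq_or_lt with rfl | h
  · exact measurable_iff_comap_le.2 (le_sup_right.trans (le_sup_left.trans le_sup_left))
  · exact (R.measurable_noise_history h).mono (R.history_le_historyQuery t) le_rfl

theorem measurable_dir_historyDir (t : ℕ) : Measurable[R.historyDir t] (R.dir (t + 1)) :=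
  measurable_iff_comap_le.2 le_sup_right

theorem measurable_iterate_historyQuery (x₀ : Vec d) (t : ℕ) :
    Measurable[R.historyQuery t] (R.iterate x₀ (t + 1)) := by
  have h1 := (R.measurable_iterate_history x₀ t).mono (R.history_le_historyQuery t) le_rfl
  have h2 : Measurable[R.historyQuery t] (R.scale (t + 1)) :=
    measurable_iff_comap_le.2 le_sup_right
  have h3 := (R.measurable_dir_historyDir t).mono (R.historyDir_le_historyQuery t) le_rfl
  exact (show Measurable fun p : Vec d × ℝ × Vec d => p.1 + p.2.1 • p.2.2 by fun_prop).comp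
    (h1.prodMk (h2.prodMk h3))

theorem measurable_gradient_iterate_apply (f : Vec d → ℝ) (x₀ : Vec d) (t : ℕ) (i : Fin d) :
    Measurable[R.historyQuery t] fun ω => gradient f (R.iterate x₀ (t + 1) ω) i :=
  ((show Measurable fun v : Vec d => v i by fun_prop).comp (measurable_gradient f)).comp
    (R.measurable_iterate_historyQuery x₀ t)

theorem tracker_nonneg (t : ℕ) (ω : Ω) (i : Fin d) : 0 ≤ R.tracker t ω i := by
  induction t with
  | zero => exact le_rfl
  | succ t ih => exact ih.trans (le_max_left _ _)

theorem tracker_mono {s t : ℕ} (h : s ≤ t) (ω : Ω) (i : Fin d) :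
    R.tracker s ω i ≤ R.tracker t ω i := by
  induction t, h using Nat.le_induction with
  | base => exact le_rfl
  | succ t _ ih => exact ih.trans (le_max_left _ _)

theorem abs_grad_le_tracker {t : ℕ} (ht : 1 ≤ t) (ω : Ω) (i : Fin d) :
    |R.grad t ω i| ≤ R.tracker t ω i := by
  obtain ⟨t, rfl⟩ : ∃ s, t = s + 1 := ⟨t - 1, by omega⟩
  exact le_max_right _ _

theorem enorm_tracker_le (t : ℕ) (ω : Ω) (i : Fin d) :
    ‖R.tracker t ω i‖ₑ ≤ ⨆ s ∈ Finset.Icc 1 t, ‖R.grad s ω i‖ₑ := by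
  induction t with
  | zero => simp [tracker]
  | succ t ih =>
    rw [tracker]
    rcases max_choice (R.tracker t ω i) |R.grad (t + 1) ω i| with h | h <;> simp only [h]
    · refine ih.trans (biSup_mono fun s hs => ?_)
      rw [Finset.mem_Icc] at hs ⊢; omega
    · rw [Real.enorm_abs]
      exact le_biSup (fun s => ‖R.grad s ω i‖ₑ) (by simp)

end Filtration

/-- The estimate `G ⊙ sgn (g + G ⊙ n)` of the gradient in round `t`, by which the descent
direction is updated. In the last round of each block of length `N`, whose update does not enter
the regret of that block (and whose noise is never drawn if the block is the final one), the
stochastic gradient itself is taken. -/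
noncomputable def surrogate (R : Trace d Ω) (N t : ℕ) (ω : Ω) (i : Fin d) : ℝ :=
  if N ∣ t then R.grad t ω i
  else R.tracker t ω i * Real.sign (R.grad t ω i + R.tracker t ω i * R.noise t ω i)

theorem abs_surrogate_le (R : Trace d Ω) (N : ℕ) {t : ℕ} (ht : 1 ≤ t) (ω : Ω) (i : Fin d) :
    |R.surrogate N t ω i| ≤ R.tracker t ω i := by
  rw [surrogate]
  split_ifs
  · exact R.abs_grad_le_tracker ht ω i
  · rw [abs_mul, abs_of_nonneg (R.tracker_nonneg t ω i)]
    exact mul_le_of_le_one_right (R.tracker_nonneg t ω i) (abs_sign_le_one _)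

theorem measurable_surrogate (R : Trace d Ω) (N : ℕ) {s t : ℕ} (hs : 1 ≤ s) (h : s ≤ t)
    (i : Fin d) : Measurable[R.historyQuery t] (fun ω => R.surrogate N s ω i) := by
  have hle : R.history s ≤ R.historyQuery t :=
    (R.history_mono h).trans (R.history_le_historyQuery t)
  have hg : Measurable[R.historyQuery t] fun ω => R.grad s ω i := by
    obtain ⟨s, rfl⟩ : ∃ r, s = r + 1 := ⟨s - 1, by omega⟩
    exact (show Measurable fun v : Vec d => v i by fun_prop).comp
      ((R.measurable_grad_history s.lt_succ_self).mono hle le_rfl)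
  by_cases hd : N ∣ s
  · simpa only [surrogate, if_pos hd] using hg
  · have hG := (R.measurable_tracker_history s i).mono hle le_rfl
    have hn : Measurable[R.historyQuery t] fun ω => R.noise s ω i :=
      (measurable_pi_apply i).comp (R.measurable_noise_historyQuery h)
    simp only [surrogate, if_neg hd]
    exact hG.mul (measurable_sign.comp (hg.add (hG.mul hn)))

end Trace

end StoSign

namespace StoSign.Trace

variable {d : ℕ} {Ω : Type*} [MeasurableSpace Ω] {R : Trace d Ω} {μ : Measure Ω}
  {f : Vec d → ℝ} {x₀ Δ₀ : Vec d} {K N : ℕ} {D : ℝ} {η : ℕ → ℝ}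
  {L : Vec d}

/-! ### Integrability along an execution -/

theorem exists_round {K N j n : ℕ} (hj : j < K) (h1 : 1 ≤ n) (h2 : n ≤ N) :
    ∃ t, j * N + n = t + 1 ∧ t < K * N := by
  refine ⟨j * N + n - 1, by omega, ?_⟩
  have : (j + 1) * N ≤ K * N := Nat.mul_le_mul_right N hj
  rw [add_mul, one_mul] at this
  omega

theorem CoordLipschitz.integral_tracker_sq {T : ℕ} (hLip : R.CoordLipschitz μ T L) (i : Fin d)
    (hm : Measurable fun ω => R.tracker T ω i) :
    MemLp (fun ω => R.tracker T ω i) 2 μ ∧ ∫ ω, R.tracker T ω i ^ 2 ∂μ ≤ L i ^ 2 := by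
  have hle : ∫⁻ ω, ‖R.tracker T ω i ^ 2‖ₑ ∂μ ≤ ENNReal.ofReal (L i ^ 2) := by
    refine le_trans (lintegral_mono fun ω => ?_) (hLip.2 i)
    rw [enorm_pow]
    exact pow_le_pow_left' (R.enorm_tracker_le T ω i) 2
  constructor
  · rw [memLp_two_iff_integrable_sq hm.aestronglyMeasurable]
    exact ⟨(hm.pow_const 2).aestronglyMeasurable, hle.trans_lt ENNReal.ofReal_lt_top⟩
  · rw [integral_eq_lintegral_of_nonneg_ae (ae_of_all _ fun ω => sq_nonneg _)
      (hm.pow_const 2).aestronglyMeasurable]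
    refine ENNReal.toReal_le_of_le_ofReal (sq_nonneg _) (le_trans (lintegral_mono fun ω => ?_) hle)
    rw [Real.enorm_of_nonneg (sq_nonneg _)]

namespace IsStoSignSGD

variable (hR : R.IsStoSignSGD μ f x₀ Δ₀ K N D η)

include hR

theorem history_le {t : ℕ} (ht : t ≤ K * N) : R.history t ≤ (inferInstance : MeasurableSpace Ω) :=
  iSup₂_le fun r hr => by
    have hr' : r < K * N := (Finset.mem_range.1 hr).trans_le ht
    exact sup_le (sup_le (sup_le (hR.noise_measurable r hr').comap_le
      (hR.dir_measurable r hr').comap_le) (hR.scale_measurable r hr').comap_le)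
      (hR.grad_measurable r hr').comap_le

theorem historyQuery_le {t : ℕ} (ht : t < K * N) :
    R.historyQuery t ≤ (inferInstance : MeasurableSpace Ω) :=
  (R.historyQuery_le_history t).trans (hR.history_le ht)

theorem measurable_iterate {t : ℕ} (ht : t ≤ K * N) : Measurable (R.iterate x₀ t) :=
  (R.measurable_iterate_history x₀ t).mono (hR.history_le ht) le_rfl

theorem measurable_tracker {t : ℕ} (ht : t ≤ K * N) (i : Fin d) :
    Measurable fun ω => R.tracker t ω i :=
  (R.measurable_tracker_history t i).mono (hR.history_le ht) le_rfl

theorem abs_dir_le (hD : 0 ≤ D) {t : ℕ} (ht : t < K * N) (ω : Ω) (i : Fin d) :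
    |R.dir (t + 1) ω i| ≤ D :=
  (mem_lqBall_top_zero_iff hD).1 (hR.dir_update t ht ω).1 i

theorem measurable_grad_apply {t : ℕ} (ht : t < K * N) (i : Fin d) :
    Measurable fun ω => R.grad (t + 1) ω i :=
  (show Measurable fun v : Vec d => v i by fun_prop).comp (hR.grad_measurable t ht)

theorem grad_unbiased_apply {t : ℕ} (ht : t < K * N) (i : Fin d) :
    μ[fun ω => R.grad (t + 1) ω i | R.historyQuery t] =ᵐ[μ]
      fun ω => gradient f (R.iterate x₀ (t + 1) ω) i := by
  have h := (EuclideanSpace.proj (𝕜 := ℝ) i).comp_condExp_comm (m := R.historyQuery t)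
    (hR.grad_integrable t ht)
  filter_upwards [h, hR.grad_unbiased t ht] with ω h1 h2
  rw [Function.comp_apply, h2] at h1
  exact h1.symm

theorem integrable_gradient_iterate {t : ℕ} (ht : t < K * N) :
    Integrable (fun ω => gradient f (R.iterate x₀ (t + 1) ω)) μ :=
  integrable_condExp.congr (hR.grad_unbiased t ht)

theorem aestronglyMeasurable_surrogate {t : ℕ} (ht : t < K * N) (i : Fin d) :
    AEStronglyMeasurable (fun ω => R.surrogate N (t + 1) ω i) μ := by
  have hg := hR.measurable_grad_apply ht i
  by_cases hd : N ∣ t + 1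
  · simpa only [surrogate, if_pos hd] using hg.aestronglyMeasurable
  · have ht' : t + 1 < K * N :=
      lt_of_le_of_ne ht fun h => hd (h ▸ Dvd.intro_left K rfl)
    exact ((R.measurable_surrogate N (by omega) le_rfl i).mono
      (hR.historyQuery_le ht') le_rfl).aestronglyMeasurable

theorem memLp_tracker (hLip : R.CoordLipschitz μ (K * N) L) {t : ℕ} (ht : t ≤ K * N) (i : Fin d) :
    MemLp (fun ω => R.tracker t ω i) 2 μ := by
  refine (hLip.integral_tracker_sq i (hR.measurable_tracker le_rfl i)).1.mono
    (hR.measurable_tracker ht i).aestronglyMeasurable (ae_of_all _ fun ω => ?_)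
  rw [Real.norm_of_nonneg (R.tracker_nonneg _ _ _), Real.norm_of_nonneg (R.tracker_nonneg _ _ _)]
  exact R.tracker_mono ht ω i

theorem memLp_grad (hLip : R.CoordLipschitz μ (K * N) L)
    {t : ℕ} (ht : t < K * N) (i : Fin d) :
    MemLp (fun ω => R.grad (t + 1) ω i) 2 μ := by
  refine (hR.memLp_tracker hLip ht i).mono (hR.measurable_grad_apply ht i).aestronglyMeasurable
    (ae_of_all _ fun ω => ?_)
  rw [Real.norm_of_nonneg (R.tracker_nonneg _ _ _)]
  exact R.abs_grad_le_tracker (by omega) ω i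

theorem memLp_surrogate (hLip : R.CoordLipschitz μ (K * N) L)
    {t : ℕ} (ht : t < K * N) (i : Fin d) :
    MemLp (fun ω => R.surrogate N (t + 1) ω i) 2 μ := by
  refine (hR.memLp_tracker hLip ht i).mono (hR.aestronglyMeasurable_surrogate ht i)
    (ae_of_all _ fun ω => ?_)
  rw [Real.norm_of_nonneg (R.tracker_nonneg _ _ _)]
  exact R.abs_surrogate_le N (by omega) ω i

theorem memLp_gradient_iterate (hLip : R.CoordLipschitz μ (K * N) L)
    {t : ℕ} (ht : t < K * N) (i : Fin d) :
    MemLp (fun ω => gradient f (R.iterate x₀ (t + 1) ω) i) 2 μ :=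
  ((hR.memLp_grad hLip ht i).condExp (by norm_num)).ae_eq (hR.grad_unbiased_apply ht i)

variable [IsProbabilityMeasure μ]

/-- Unbiasedness of the oracle, tested against a variable known at the time of the query. -/
theorem integral_mul_gradient {t : ℕ} (ht : t < K * N) (i : Fin d) {Z : Ω → ℝ}
    (hZ : Measurable[R.historyQuery t] Z)
    (hi : Integrable (fun ω => Z ω * R.grad (t + 1) ω i) μ) :
    Integrable (fun ω => Z ω * gradient f (R.iterate x₀ (t + 1) ω) i) μ ∧
    ∫ ω, Z ω * gradient f (R.iterate x₀ (t + 1) ω) i ∂μ = ∫ ω, Z ω * R.grad (t + 1) ω i ∂μ := by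
  have hg : Integrable (fun ω => R.grad (t + 1) ω i) μ :=
    (EuclideanSpace.proj (𝕜 := ℝ) i).integrable_comp (hR.grad_integrable t ht)
  have h1 := condExp_mul_of_aestronglyMeasurable_left (m := R.historyQuery t) (μ := μ)
    hZ.stronglyMeasurable.aestronglyMeasurable (g := fun ω => R.grad (t + 1) ω i) hi hg
  have h2 : μ[Z * fun ω => R.grad (t + 1) ω i | R.historyQuery t] =ᵐ[μ]
      fun ω => Z ω * gradient f (R.iterate x₀ (t + 1) ω) i := by
    filter_upwards [h1, hR.grad_unbiased_apply ht i] with ω h3 h4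
    rw [h3, Pi.mul_apply, h4]
  refine ⟨integrable_condExp.congr h2, ?_⟩
  rw [← integral_congr_ae h2, integral_condExp (hR.historyQuery_le ht)]
  rfl

/-- Multiplied by any variable known when the oracle is queried, the surrogate has the same mean
as the true gradient. -/
theorem integral_mul_surrogate {t : ℕ} (ht : t < K * N) (i : Fin d) {Z : Ω → ℝ}
    (hZ : Measurable[R.historyQuery t] Z)
    (hi : Integrable (fun ω => Z ω * R.tracker (t + 1) ω i) μ) :
    ∫ ω, Z ω * R.surrogate N (t + 1) ω i ∂μ
      = ∫ ω, Z ω * gradient f (R.iterate x₀ (t + 1) ω) i ∂μ := by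
  have hZ' : Measurable Z := hZ.mono (hR.historyQuery_le ht) le_rfl
  have hig : Integrable (fun ω => Z ω * R.grad (t + 1) ω i) μ := by
    refine hi.mono (hZ'.mul (hR.measurable_grad_apply ht i)).aestronglyMeasurable
      (ae_of_all _ fun ω => ?_)
    rw [norm_mul, norm_mul, Real.norm_of_nonneg (R.tracker_nonneg _ _ _)]
    exact mul_le_mul_of_nonneg_left (R.abs_grad_le_tracker (by omega) ω i) (norm_nonneg _)
  rw [(hR.integral_mul_gradient ht i hZ hig).2]
  by_cases hd : N ∣ t + 1
  · simp only [surrogate, if_pos hd]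
  · have ht' : t + 1 < K * N :=
      lt_of_le_of_ne ht fun h => hd (h ▸ Dvd.intro_left K rfl)
    simp only [surrogate, if_neg hd]
    have hn := hR.noise_measurable (t + 1) ht'
    refine integral_mul_sign (m := R.history (t + 1)) (hR.history_le ht)
      (hZ.mono (R.historyQuery_le_history t) le_rfl)
      ((show Measurable fun v : Vec d => v i by fun_prop).comp
        (R.measurable_grad_history t.lt_succ_self))
      (R.measurable_tracker_history (t + 1) i) ((measurable_pi_apply i).comp hn)
      (map_apply_uniform_cube hn (hR.noise_law (t + 1) ht') i) ?_
      (fun ω => R.abs_grad_le_tracker (by omega) ω i) hi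
    refine indep_of_indep_of_le_left (hR.noise_indep (t + 1) ht') ?_
    exact ((measurable_pi_apply i).comp (comap_measurable (R.noise (t + 1)))).comap_le

variable (hLip : R.CoordLipschitz μ (K * N) L)

include hLip

theorem integral_tracker_le {t : ℕ} (ht : t ≤ K * N) (i : Fin d) :
    ∫ ω, R.tracker t ω i ∂μ ≤ L i := by
  have hT := hLip.integral_tracker_sq i (hR.measurable_tracker le_rfl i)
  calc ∫ ω, R.tracker t ω i ∂μ ≤ ∫ ω, |R.tracker (K * N) ω i| ∂μ := by
        refine integral_mono ((hR.memLp_tracker hLip ht i).integrable one_le_two)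
          (hT.1.integrable one_le_two).abs fun ω => ?_
        exact (R.tracker_mono ht ω i).trans (le_abs_self _)
    _ ≤ √(∫ ω, R.tracker (K * N) ω i ^ 2 ∂μ) := integral_abs_le_sqrt hT.1
    _ ≤ √(L i ^ 2) := Real.sqrt_le_sqrt hT.2
    _ = L i := Real.sqrt_sq (hLip.1 i)

/-! ### Noise of one block -/

/-- The errors of the surrogates in a block are orthogonal in `L²`, because an earlier error is known
when a later gradient is queried. -/
theorem integral_abs_noise_le {j : ℕ} (hj : j < K) (i : Fin d) :
    ∫ ω, |∑ n ∈ Finset.Icc 1 N, (R.surrogate N (j * N + n) ω i -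
      gradient f (R.iterate x₀ (j * N + n) ω) i)| ∂μ ≤ √N * L i := by
  have hlt : ∀ n, 1 ≤ n → n ≤ N → ∃ t, j * N + n = t + 1 ∧ t < K * N :=
    fun n h1 h2 => exists_round hj h1 h2
  have hmem : ∀ n ∈ Finset.Icc 1 N, MemLp (fun ω => R.surrogate N (j * N + n) ω i -
      gradient f (R.iterate x₀ (j * N + n) ω) i) 2 μ := by
    intro n hn
    rw [Finset.mem_Icc] at hn
    obtain ⟨t, ht, htT⟩ := hlt n hn.1 hn.2
    rw [ht]
    exact (hR.memLp_surrogate hLip htT i).sub (hR.memLp_gradient_iterate hLip htT i)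
  refine integral_abs_sum_le (hLip.1 i) hmem ?_ ?_
  · -- the variance of the surrogate is at most its second moment
    intro n hn
    rw [Finset.mem_Icc] at hn
    obtain ⟨t, ht, htT⟩ := hlt n hn.1 hn.2
    rw [ht]
    have hs := hR.memLp_surrogate hLip htT i
    have ha := hR.memLp_gradient_iterate hLip htT i
    have hG := hR.memLp_tracker hLip htT i
    have hT := hLip.integral_tracker_sq i (hR.measurable_tracker le_rfl i)
    have hcross := hR.integral_mul_surrogate htT i (R.measurable_gradient_iterate_apply f x₀ t i)
      (ha.integrable_mul hG)
    have e : ∀ ω, (R.surrogate N (t + 1) ω i - gradient f (R.iterate x₀ (t + 1) ω) i) ^ 2 =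
        R.surrogate N (t + 1) ω i ^ 2 -
        2 * (gradient f (R.iterate x₀ (t + 1) ω) i * R.surrogate N (t + 1) ω i) +
        gradient f (R.iterate x₀ (t + 1) ω) i * gradient f (R.iterate x₀ (t + 1) ω) i :=
      fun ω => by ring
    simp only [e]
    have i1 := hs.integrable_sq
    have i2 : Integrable (fun ω => 2 * (gradient f (R.iterate x₀ (t + 1) ω) i *
        R.surrogate N (t + 1) ω i)) μ := (ha.integrable_mul hs).const_mul 2
    have i12 : Integrable (fun ω => R.surrogate N (t + 1) ω i ^ 2 -
        2 * (gradient f (R.iterate x₀ (t + 1) ω) i * R.surrogate N (t + 1) ω i)) μ := i1.sub i2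
    have i3 : Integrable (fun ω => gradient f (R.iterate x₀ (t + 1) ω) i *
        gradient f (R.iterate x₀ (t + 1) ω) i) μ := ha.integrable_mul ha
    rw [integral_add i12 i3, integral_sub i1 i2, integral_const_mul, hcross]
    have h1 : ∫ ω, R.surrogate N (t + 1) ω i ^ 2 ∂μ ≤ ∫ ω, R.tracker (K * N) ω i ^ 2 ∂μ := by
      refine integral_mono i1 hT.1.integrable_sq fun ω => ?_
      exact sq_le_sq.2 (((R.abs_surrogate_le N (by omega) ω i).trans
        (R.tracker_mono htT ω i)).trans (le_abs_self _))
    have h2 : 0 ≤ ∫ ω, gradient f (R.iterate x₀ (t + 1) ω) i *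
        gradient f (R.iterate x₀ (t + 1) ω) i ∂μ := integral_nonneg fun ω => mul_self_nonneg _
    linarith [hT.2]
  · intro n n' h1 h2 h3
    obtain ⟨s, hs, hsT⟩ := hlt n h1 (by omega)
    obtain ⟨t, ht, htT⟩ := hlt n' (by omega) h3
    have hm := hmem n (Finset.mem_Icc.2 ⟨h1, by omega⟩)
    rw [ht]
    rw [hs] at hm ⊢
    have hst : s + 1 ≤ t := by omega
    have hZ : Measurable[R.historyQuery t] fun ω => R.surrogate N (s + 1) ω i -
        gradient f (R.iterate x₀ (s + 1) ω) i := by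
      have hle : R.historyQuery s ≤ R.historyQuery t :=
        (R.historyQuery_le_history s).trans
          ((R.history_mono hst).trans (R.history_le_historyQuery t))
      exact (R.measurable_surrogate N (by omega) hst i).sub
        ((R.measurable_gradient_iterate_apply f x₀ s i).mono hle le_rfl)
    have hcross := hR.integral_mul_surrogate htT i hZ
      (hm.integrable_mul (hR.memLp_tracker hLip htT i))
    simp only [mul_sub (_ - _)]
    have i1 : Integrable (fun ω => (R.surrogate N (s + 1) ω i -
        gradient f (R.iterate x₀ (s + 1) ω) i) * R.surrogate N (t + 1) ω i) μ :=
      hm.integrable_mul (hR.memLp_surrogate hLip htT i)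
    have i2 : Integrable (fun ω => (R.surrogate N (s + 1) ω i -
        gradient f (R.iterate x₀ (s + 1) ω) i) * gradient f (R.iterate x₀ (t + 1) ω) i) μ :=
      hm.integrable_mul (hR.memLp_gradient_iterate hLip htT i)
    rw [integral_sub i1 i2]
    exact sub_eq_zero.2 hcross

end IsStoSignSGD

end StoSign.Trace

namespace StoSign

/-! ### Expected descent and gradient norms -/

theorem sum_range_mul_eq {M : Type*} [AddCommMonoid M] (F : ℕ → M) (K N : ℕ) :
    ∑ t ∈ Finset.range (K * N), F (t + 1) =
      ∑ j ∈ Finset.range K, ∑ n ∈ Finset.Icc 1 N, F (j * N + n) := by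
  have hI : ∀ g : ℕ → M, ∑ n ∈ Finset.Icc 1 N, g n = ∑ n ∈ Finset.range N, g (n + 1) := by
    intro g
    rw [Finset.range_eq_Ico, Finset.sum_Ico_add']
    rfl
  induction K with
  | zero => simp
  | succ K ih => rw [add_mul, one_mul, Finset.sum_range_add, ih, Finset.sum_range_succ, hI]; rfl

theorem stepSize_block (D : ℝ) {N j n : ℕ} (h1 : 1 ≤ n) (h2 : n ≤ N) :
    stepSize D N (j * N + n) = √2 * D / √n := by
  obtain ⟨m, rfl⟩ : ∃ m, n = m + 1 := ⟨n - 1, by omega⟩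
  rw [← add_assoc, stepSize, mul_comm j, Nat.mul_add_mod, Nat.mod_eq_of_lt (by omega)]
  push_cast
  rfl

namespace Trace

variable {d : ℕ} {Ω : Type*} [MeasurableSpace Ω] {R : Trace d Ω} {μ : Measure Ω}
  {f : Vec d → ℝ} {x₀ Δ₀ : Vec d} {K N : ℕ} {D : ℝ} {η : ℕ → ℝ}
  {L : Vec d}

namespace IsStoSignSGD

theorem integrable_gradient_mul_dir (hR : R.IsStoSignSGD μ f x₀ Δ₀ K N D η) (hD : 0 ≤ D) {t : ℕ}
    (ht : t < K * N) (i : Fin d) :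
    Integrable (fun ω => gradient f (R.iterate x₀ (t + 1) ω) i * R.dir (t + 1) ω i) μ := by
  have hg : Integrable (fun ω => gradient f (R.iterate x₀ (t + 1) ω) i) μ :=
    (EuclideanSpace.proj (𝕜 := ℝ) i).integrable_comp (hR.integrable_gradient_iterate ht)
  have hd : Measurable fun ω => R.dir (t + 1) ω i :=
    (show Measurable fun v : Vec d => v i by fun_prop).comp (hR.dir_measurable t ht)
  exact hg.mul_bdd (c := D) hd.aestronglyMeasurable (ae_of_all _ fun ω => hR.abs_dir_le hD ht ω i)

/-- Random scaling along one round of the algorithm. -/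
theorem integral_step [IsProbabilityMeasure μ]
    (hR : R.IsStoSignSGD μ f x₀ Δ₀ K N D η) (hf : WellBehaved f) (hD : 0 ≤ D)
    {t : ℕ} (ht : t < K * N) :
    Integrable (fun ω => f (R.iterate x₀ (t + 1) ω) - f (R.iterate x₀ t ω)) μ ∧
    ∫ ω, (f (R.iterate x₀ (t + 1) ω) - f (R.iterate x₀ t ω)) ∂μ =
      ∑ i, ∫ ω, gradient f (R.iterate x₀ (t + 1) ω) i * R.dir (t + 1) ω i ∂μ := by
  have hinner : ∀ ω, inner ℝ (gradient f (R.iterate x₀ (t + 1) ω)) (R.dir (t + 1) ω) =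
      ∑ i, gradient f (R.iterate x₀ (t + 1) ω) i * R.dir (t + 1) ω i := fun ω => by
    rw [PiLp.inner_apply]
    exact Finset.sum_congr rfl fun i _ => mul_comm _ _
  have hgi : ∀ i ∈ Finset.univ, Integrable (fun ω => gradient f (R.iterate x₀ (t + 1) ω) i *
      R.dir (t + 1) ω i) μ := fun i _ => hR.integrable_gradient_mul_dir hD ht i
  have hind : IndepFun (fun ω => (R.iterate x₀ t ω, R.dir (t + 1) ω)) (R.scale (t + 1)) μ := by
    refine indep_of_indep_of_le_left (hR.scale_indep t ht).symm ?_
    refine Measurable.comap_le (Measurable.prodMk ?_ (R.measurable_dir_historyDir t))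
    exact (R.measurable_iterate_history x₀ t).mono (le_sup_left.trans le_sup_left) le_rfl
  have h := hf.random_scaling (hR.measurable_iterate ht.le) (hR.dir_measurable t ht)
    (hR.scale_measurable t ht) (hR.scale_law t ht) hind
    ((integrable_finsetSum _ hgi).congr (ae_of_all _ fun ω => (hinner ω).symm))
  refine ⟨h.1, h.2.trans ?_⟩
  rw [← integral_finsetSum _ hgi]
  exact integral_congr_ae (ae_of_all _ hinner)

/-- The total expected linearized change of `f` is at least `- Δf`. -/
theorem neg_le_sum_gradient_mul_dir [IsProbabilityMeasure μ]
    (hR : R.IsStoSignSGD μ f x₀ Δ₀ K N D η) (hf : WellBehaved f)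
    (hbdd : BddBelow (Set.range f)) {Δf : ℝ} (hgap : f x₀ - ⨅ x, f x ≤ Δf) (hD : 0 ≤ D) :
    -Δf ≤ ∑ t ∈ Finset.range (K * N),
      ∑ i, ∫ ω, gradient f (R.iterate x₀ (t + 1) ω) i * R.dir (t + 1) ω i ∂μ := by
  have hi : ∀ t ∈ Finset.range (K * N),
      Integrable (fun ω => f (R.iterate x₀ (t + 1) ω) - f (R.iterate x₀ t ω)) μ :=
    fun t ht => (hR.integral_step hf hD (Finset.mem_range.1 ht)).1
  have e : ∑ t ∈ Finset.range (K * N),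
      ∑ i, ∫ ω, gradient f (R.iterate x₀ (t + 1) ω) i * R.dir (t + 1) ω i ∂μ =
      ∫ ω, ∑ t ∈ Finset.range (K * N),
        (f (R.iterate x₀ (t + 1) ω) - f (R.iterate x₀ t ω)) ∂μ := by
    rw [integral_finsetSum _ hi]
    exact Finset.sum_congr rfl fun t ht => (hR.integral_step hf hD (Finset.mem_range.1 ht)).2.symm
  rw [e]
  calc -Δf = ∫ _, -Δf ∂μ := by simp
    _ ≤ _ := by
      refine integral_mono (integrable_const _) (integrable_finsetSum _ hi) fun ω => ?_
      simp only
      rw [Finset.sum_range_sub (fun t => f (R.iterate x₀ t ω))]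
      have := ciInf_le hbdd (R.iterate x₀ (K * N) ω)
      simp only [iterate]
      linarith

theorem integrable_abs_sum_gradient (hR : R.IsStoSignSGD μ f x₀ Δ₀ K N D η) {j : ℕ} (hj : j < K)
    (i : Fin d) :
    Integrable (fun ω => |∑ n ∈ Finset.Icc 1 N, gradient f (R.iterate x₀ (j * N + n) ω) i|) μ := by
  refine (integrable_finsetSum _ fun n hn => ?_).abs
  rw [Finset.mem_Icc] at hn
  obtain ⟨t, ht, htT⟩ := exists_round hj hn.1 hn.2
  rw [ht]
  exact (EuclideanSpace.proj (𝕜 := ℝ) i).integrable_comp (hR.integrable_gradient_iterate htT)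

/-- The regret bound of one block in one coordinate, in expectation. -/
theorem block_expectation [IsProbabilityMeasure μ]
    (hR : R.IsStoSignSGD μ f x₀ Δ₀ K N D (stepSize D N))
    (hLip : R.CoordLipschitz μ (K * N) L) (hD : 0 < D) (hN : 1 ≤ N) {j : ℕ} (hj : j < K)
    (i : Fin d) :
    ∑ n ∈ Finset.Icc 1 N,
        ∫ ω, gradient f (R.iterate x₀ (j * N + n) ω) i * R.dir (j * N + n) ω i ∂μ +
      D * ∫ ω, |∑ n ∈ Finset.Icc 1 N, gradient f (R.iterate x₀ (j * N + n) ω) i| ∂μ ≤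
      6 * D * √N * L i := by
  have hr : ∀ n, 1 ≤ n → n ≤ N → ∃ t, j * N + n = t + 1 ∧ t < K * N :=
    fun n h1 h2 => exists_round hj h1 h2
  have hend : j * N + N ≤ K * N := by
    calc j * N + N = (j + 1) * N := by ring
      _ ≤ K * N := Nat.mul_le_mul_right N hj
  have hpoint : ∀ ω, ∑ n ∈ Finset.Icc 1 N, R.surrogate N (j * N + n) ω i * R.dir (j * N + n) ω i +
      D * |∑ n ∈ Finset.Icc 1 N, gradient f (R.iterate x₀ (j * N + n) ω) i| ≤
      5 * D * √N * R.tracker (j * N + N) ω i +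
      D * |∑ n ∈ Finset.Icc 1 N, (R.surrogate N (j * N + n) ω i -
        gradient f (R.iterate x₀ (j * N + n) ω) i)| := by
    intro ω
    refine block_bound (G := fun n => R.tracker (j * N + n) ω i)
      (σ := fun n => stoSign (R.tracker (j * N + n) ω) (R.grad (j * N + n) ω)
        (R.noise (j * N + n) ω) i)
      (x := fun n => R.dir (j * N + n) ω i) (h := fun n => R.surrogate N (j * N + n) ω i)
      hN hD (fun n => R.tracker_nonneg _ _ _)
      (fun n _ _ => R.tracker_mono (Nat.le_succ _) ω i) (fun n => ?_) (fun n h1 h2 => ?_)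
      (fun u hu n h1 h2 => ?_) (fun n h1 h2 => ?_) (R.abs_surrogate_le N (by omega) ω i) _
    · rw [sq_le_one_iff_abs_le_one]
      exact abs_sign_le_one _
    · obtain ⟨t, ht, htT⟩ := hr n h1 h2
      simp only [ht]
      exact hR.abs_dir_le hD.le htT ω i
    · have hup := (hR.dir_update (j * N + n) (by omega) ω).mul_sub_sq_le hD.le
        (R.tracker_nonneg _ ω i) hu
      rw [stepSize_block D h1 h2.le] at hup
      exact hup
    · have hnd : ¬ N ∣ j * N + n := fun hd =>
        absurd (Nat.le_of_dvd (by omega) ((Nat.dvd_add_right (Dvd.intro_left j rfl)).1 hd))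
          (by omega)
      simp only [surrogate, if_neg hnd, stoSign]
  -- replacing the surrogate by the gradient in the linear term
  have hlin : ∀ n ∈ Finset.Icc 1 N,
      Integrable (fun ω => R.surrogate N (j * N + n) ω i * R.dir (j * N + n) ω i) μ ∧
      ∫ ω, gradient f (R.iterate x₀ (j * N + n) ω) i * R.dir (j * N + n) ω i ∂μ =
        ∫ ω, R.surrogate N (j * N + n) ω i * R.dir (j * N + n) ω i ∂μ := by
    intro n hn
    rw [Finset.mem_Icc] at hn
    obtain ⟨t, ht, htT⟩ := hr n hn.1 hn.2
    rw [ht]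
    have hdm : Measurable[R.historyQuery t] fun ω => R.dir (t + 1) ω i :=
      (show Measurable fun v : Vec d => v i by fun_prop).comp
        ((R.measurable_dir_historyDir t).mono (R.historyDir_le_historyQuery t) le_rfl)
    have hdm' : AEStronglyMeasurable (fun ω => R.dir (t + 1) ω i) μ :=
      (hdm.mono (hR.historyQuery_le htT) le_rfl).aestronglyMeasurable
    have hb : ∀ᵐ ω ∂μ, ‖R.dir (t + 1) ω i‖ ≤ D := ae_of_all _ fun ω => hR.abs_dir_le hD.le htT ω i
    refine ⟨((hR.memLp_surrogate hLip htT i).integrable one_le_two).mul_bdd (c := D) hdm' hb, ?_⟩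
    have hGi : Integrable (fun ω => R.dir (t + 1) ω i * R.tracker (t + 1) ω i) μ :=
      ((hR.memLp_tracker hLip htT i).integrable one_le_two).bdd_mul (c := D) hdm' hb
    have := hR.integral_mul_surrogate htT i hdm hGi
    simp only [mul_comm (R.dir (t + 1) _ i)] at this
    exact this.symm
  have hG := (hR.memLp_tracker hLip hend i).integrable one_le_two
  have hnoise : Integrable (fun ω => |∑ n ∈ Finset.Icc 1 N, (R.surrogate N (j * N + n) ω i -
      gradient f (R.iterate x₀ (j * N + n) ω) i)|) μ := by
    refine (integrable_finsetSum _ fun n hn => ?_).abs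
    rw [Finset.mem_Icc] at hn
    obtain ⟨t, ht, htT⟩ := hr n hn.1 hn.2
    rw [ht]
    exact ((hR.memLp_surrogate hLip htT i).sub (hR.memLp_gradient_iterate hLip htT i)).integrable
      one_le_two
  have hsum : Integrable (fun ω => ∑ n ∈ Finset.Icc 1 N,
      R.surrogate N (j * N + n) ω i * R.dir (j * N + n) ω i) μ :=
    integrable_finsetSum _ fun n hn => (hlin n hn).1
  have hgrad := hR.integrable_abs_sum_gradient hj i
  have hint := integral_mono (hsum.add (hgrad.const_mul D))
    ((hG.const_mul (5 * D * √N)).add (hnoise.const_mul D)) hpoint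
  simp only [Pi.add_apply] at hint
  rw [integral_add hsum (hgrad.const_mul D), integral_add (hG.const_mul _) (hnoise.const_mul D),
    integral_finsetSum _ fun n hn => (hlin n hn).1, integral_const_mul, integral_const_mul,
    integral_const_mul, ← Finset.sum_congr rfl fun n hn => (hlin n hn).2] at hint
  have h1 := hR.integral_abs_noise_le hLip hj i
  have h2 := hR.integral_tracker_le hLip hend i
  have h3 : 5 * D * √N * ∫ ω, R.tracker (j * N + N) ω i ∂μ ≤ 5 * D * √N * L i := by gcongr
  have h4 := mul_le_mul_of_nonneg_left h1 hD.le
  linarith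

theorem integrable_vecNorm_sum_gradient (hR : R.IsStoSignSGD μ f x₀ Δ₀ K N D η) {j : ℕ}
    (hj : j < K) :
    Integrable (fun ω =>
      vecNorm 1 (∑ n ∈ Finset.Icc 1 N, gradient f (R.iterate x₀ (j * N + n) ω))) μ := by
  simp only [vecNorm_one_eq, WithLp.ofLp_sum, Finset.sum_apply]
  exact integrable_finsetSum _ fun i _ => hR.integrable_abs_sum_gradient hj i

/-- The averaged gradients of the blocks are small in expectation: the value decrease and the
regret bounds combined. -/
theorem sum_integral_vecNorm_le [IsProbabilityMeasure μ]
    (hR : R.IsStoSignSGD μ f x₀ Δ₀ K N D (stepSize D N))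
    (hf : WellBehaved f) (hbdd : BddBelow (Set.range f)) {Δf : ℝ}
    (hgap : f x₀ - ⨅ x, f x ≤ Δf) (hLip : R.CoordLipschitz μ (K * N) L) (hD : 0 < D)
    (hN : 1 ≤ N) :
    D * ∑ j ∈ Finset.range K, ∫ ω,
        vecNorm 1 (∑ n ∈ Finset.Icc 1 N, gradient f (R.iterate x₀ (j * N + n) ω)) ∂μ ≤
      Δf + K * (6 * D * √N * vecNorm 1 L) := by
  have h1 := hR.neg_le_sum_gradient_mul_dir hf hbdd hgap hD.le
  rw [sum_range_mul_eq (fun t =>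
    ∑ i, ∫ ω, gradient f (R.iterate x₀ t ω) i * R.dir t ω i ∂μ)] at h1
  have h2 : ∀ j ∈ Finset.range K,
      (∑ n ∈ Finset.Icc 1 N, ∑ i, ∫ ω,
        gradient f (R.iterate x₀ (j * N + n) ω) i * R.dir (j * N + n) ω i ∂μ) +
      D * ∫ ω, vecNorm 1 (∑ n ∈ Finset.Icc 1 N, gradient f (R.iterate x₀ (j * N + n) ω)) ∂μ ≤
      6 * D * √N * vecNorm 1 L := by
    intro j hj
    have hj := Finset.mem_range.1 hj
    simp only [vecNorm_one_eq, WithLp.ofLp_sum, Finset.sum_apply]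
    rw [integral_finsetSum _ fun i _ => hR.integrable_abs_sum_gradient hj i, Finset.sum_comm,
      Finset.mul_sum, ← Finset.sum_add_distrib, Finset.mul_sum]
    refine Finset.sum_le_sum fun i _ => ?_
    rw [abs_of_nonneg (hLip.1 i)]
    exact hR.block_expectation hLip hD hN hj i
  have h3 := Finset.sum_le_sum h2
  rw [Finset.sum_add_distrib, ← Finset.mul_sum, Finset.sum_const, Finset.card_range,
    nsmul_eq_mul] at h3
  linarith

/-! ### Displacement inside a block -/

theorem vecNorm_iterate_sub_le (hR : R.IsStoSignSGD μ f x₀ Δ₀ K N D η) (hD : 0 ≤ D) {j : ℕ}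
    (hj : j < K) (ω : Ω) {n n' : ℕ} (hnn : n ≤ n') (hn' : n' ≤ N) :
    vecNorm ∞ (R.iterate x₀ (j * N + n') ω - R.iterate x₀ (j * N + n) ω) ≤
      D * ∑ m ∈ Finset.Icc 1 N, |R.scale (j * N + m) ω| := by
  have h : vecNorm ∞ (R.iterate x₀ (j * N + n') ω - R.iterate x₀ (j * N + n) ω) ≤
      D * ∑ m ∈ Finset.Ioc n n', |R.scale (j * N + m) ω| := by
    induction n', hnn using Nat.le_induction with
    | base => simp [vecNorm_zero]
    | succ m hm ih =>
      have ih := ih (by omega)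
      have hdir : vecNorm ∞ (R.dir (j * N + (m + 1)) ω) ≤ D := by
        obtain ⟨t, ht, htT⟩ := exists_round hj (show 1 ≤ m + 1 by omega) hn'
        rw [ht, vecNorm_top_le_iff hD]
        exact fun i => hR.abs_dir_le hD htT ω i
      rw [← Finset.insert_Ioc_right_eq_Ioc_add_one hm, Finset.sum_insert (by simp), mul_add]
      have e : R.iterate x₀ (j * N + (m + 1)) ω - R.iterate x₀ (j * N + n) ω =
          R.scale (j * N + (m + 1)) ω • R.dir (j * N + (m + 1)) ω +
          (R.iterate x₀ (j * N + m) ω - R.iterate x₀ (j * N + n) ω) := by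
        rw [← add_assoc, iterate]; abel
      rw [e]
      refine (vecNorm_add_le _ _ _).trans (add_le_add ?_ ih)
      rw [vecNorm_smul, mul_comm]
      exact mul_le_mul_of_nonneg_right hdir (abs_nonneg _)
  refine h.trans (mul_le_mul_of_nonneg_left ?_ hD)
  refine Finset.sum_le_sum_of_subset_of_nonneg (fun m hm => ?_) fun _ _ _ => abs_nonneg _
  rw [Finset.mem_Ioc] at hm
  rw [Finset.mem_Icc]
  omega

theorem vecNorm_iterate_sub_blockAverage_le (hR : R.IsStoSignSGD μ f x₀ Δ₀ K N D η) (hD : 0 ≤ D)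
    {j : ℕ} (hj : j < K) (ω : Ω) {n : ℕ} (h1 : 1 ≤ n) (hn : n ≤ N) :
    vecNorm ∞ (R.iterate x₀ (j * N + n) ω - R.blockAverage x₀ N (j + 1) ω) ≤
      D * ∑ m ∈ Finset.Icc 1 N, |R.scale (j * N + m) ω| := by
  have hN : (N : ℝ) ≠ 0 := by
    have : N ≠ 0 := by omega
    exact_mod_cast this
  have e : R.iterate x₀ (j * N + n) ω - R.blockAverage x₀ N (j + 1) ω =
      (N : ℝ)⁻¹ • ∑ m ∈ Finset.Icc 1 N,
        (R.iterate x₀ (j * N + n) ω - R.iterate x₀ (j * N + m) ω) := by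
    rw [Finset.sum_sub_distrib, Finset.sum_const, Nat.card_Icc, smul_sub, blockAverage]
    simp only [Nat.add_sub_cancel]
    rw [← Nat.cast_smul_eq_nsmul ℝ, smul_smul, inv_mul_cancel₀ hN, one_smul]
  rw [e, vecNorm_smul, abs_of_nonneg (by positivity)]
  have hs : vecNorm ∞ (∑ m ∈ Finset.Icc 1 N,
      (R.iterate x₀ (j * N + n) ω - R.iterate x₀ (j * N + m) ω)) ≤
      ∑ m ∈ Finset.Icc 1 N, D * ∑ m ∈ Finset.Icc 1 N, |R.scale (j * N + m) ω| := by
    refine (Finset.le_sum_of_subadditive (vecNorm ∞) (vecNorm_zero ∞).le (vecNorm_add_le ∞) _ _).trans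
      (Finset.sum_le_sum fun m hm => ?_)
    rw [Finset.mem_Icc] at hm
    rcases le_total m n with hmn | hmn
    · exact hR.vecNorm_iterate_sub_le hD hj ω hmn hn
    · have hneg := vecNorm_smul ∞ (-1) (R.iterate x₀ (j * N + m) ω - R.iterate x₀ (j * N + n) ω)
      rw [neg_one_smul, neg_sub, abs_neg, abs_one, one_mul] at hneg
      rw [hneg]
      exact hR.vecNorm_iterate_sub_le hD hj ω hmn hm.2
  rw [Finset.sum_const, Nat.card_Icc, nsmul_eq_mul] at hs
  rw [inv_mul_le_iff₀ (by positivity)]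
  simpa using hs

theorem integral_scale_sq (hR : R.IsStoSignSGD μ f x₀ Δ₀ K N D η) {t : ℕ} (ht : t < K * N) :
    Integrable (fun ω => R.scale (t + 1) ω ^ 2) μ ∧ ∫ ω, R.scale (t + 1) ω ^ 2 ∂μ = 2 := by
  have hs := (hR.scale_measurable t ht).aemeasurable (μ := μ)
  constructor
  · have h := integrable_sq_expMeasure_one
    rw [← hR.scale_law t ht] at h
    exact (integrable_map_measure (by fun_prop) hs).1 h
  · rw [← integral_sq_expMeasure_one, ← hR.scale_law t ht, integral_map hs (by fun_prop)]

end IsStoSignSGD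

end Trace

/-! ### A uniformly drawn block -/

section Index

variable {Ω : Type*} {m mΩ : MeasurableSpace Ω} {μ : Measure Ω} {κ : Ω → ℕ} {K : ℕ}

theorem real_preimage_uniform (hκ : Measurable κ)
    (hlaw : μ.map κ = uniformOn (Set.Icc 1 K)) {k : ℕ} (hk : k ∈ Finset.Icc 1 K) :
    μ.real (κ ⁻¹' {k}) = (K : ℝ)⁻¹ := by
  have h1 : μ (κ ⁻¹' {k}) = uniformOn (Set.Icc 1 K) {k} := by
    rw [← hlaw, Measure.map_apply hκ (measurableSet_singleton k)]
  have h2 := uniformOn_apply_finset (s := Finset.Icc 1 K) (t := {k})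
  rw [Finset.coe_Icc, Finset.coe_singleton, Finset.inter_singleton_of_mem hk] at h2
  rw [Measure.real, h1, h2]
  simp

theorem ae_mem_of_uniform (hκ : Measurable κ)
    (hlaw : μ.map κ = uniformOn (Set.Icc 1 K)) : ∀ᵐ ω ∂μ, κ ω ∈ Finset.Icc 1 K := by
  have h1 : ∀ᵐ k ∂(μ.map κ), k ∈ Set.Icc 1 K := by
    rw [hlaw]; exact ae_cond_mem measurableSet_Icc
  filter_upwards [ae_of_ae_map hκ.aemeasurable h1] with ω hω
  simpa using hω

/-- Averaging over an independent uniform index. -/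
theorem integral_sum_indicator_uniform [IsProbabilityMeasure μ] (hm : m ≤ mΩ) (hκ : Measurable κ)
    (hlaw : μ.map κ = uniformOn (Set.Icc 1 K))
    (hind : Indep (MeasurableSpace.comap κ inferInstance) m μ) {Φ : ℕ → Ω → ℝ}
    (hΦ : ∀ k ∈ Finset.Icc 1 K, Measurable[m] (Φ k))
    (hi : ∀ k ∈ Finset.Icc 1 K, Integrable (Φ k) μ) :
    ∫ ω, ∑ k ∈ Finset.Icc 1 K, (κ ⁻¹' {k}).indicator (Φ k) ω ∂μ =
      (K : ℝ)⁻¹ * ∑ k ∈ Finset.Icc 1 K, ∫ ω, Φ k ω ∂μ := by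
  have hms : ∀ k, MeasurableSet (κ ⁻¹' {k}) := fun k => hκ (measurableSet_singleton k)
  rw [integral_finsetSum _ fun k hk => (hi k hk).indicator (hms k), Finset.mul_sum]
  refine Finset.sum_congr rfl fun k hk => ?_
  have e : ∀ ω, (κ ⁻¹' {k}).indicator (Φ k) ω =
      Set.indicator {k} (fun _ => (1 : ℝ)) (κ ω) * Φ k ω := fun ω => by
    by_cases h : κ ω = k <;> simp [h]
  have hκΦ : IndepFun κ (Φ k) μ := indep_of_indep_of_le_right hind (hΦ k hk).comap_le
  have hφ : Measurable (Set.indicator {k} fun _ : ℕ => (1 : ℝ)) := measurable_of_countable _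
  have hIndep : IndepFun (fun ω => Set.indicator {k} (fun _ => (1 : ℝ)) (κ ω)) (Φ k) μ :=
    hκΦ.comp hφ measurable_id
  have h1 : ∫ ω, Set.indicator {k} (fun _ => (1 : ℝ)) (κ ω) ∂μ = (K : ℝ)⁻¹ := by
    have e1 : (fun ω => Set.indicator {k} (fun _ => (1 : ℝ)) (κ ω)) =
        (κ ⁻¹' {k}).indicator fun _ => (1 : ℝ) := by
      ext ω; by_cases h : κ ω = k <;> simp [h]
    rw [e1, integral_indicator_const _ (hms k), real_preimage_uniform hκ hlaw hk]
    simp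
  simp only [e]
  rw [hIndep.integral_fun_mul_eq_mul_integral (hφ.comp hκ).aestronglyMeasurable
    ((hΦ k hk).mono hm le_rfl).aestronglyMeasurable, h1]

end Index

/-! ### The expected stationarity measure of the output -/

namespace Trace.IsStoSignSGD

variable {d : ℕ} {Ω : Type*} [MeasurableSpace Ω] {R : Trace d Ω} {μ : Measure Ω}
  {f : Vec d → ℝ} {x₀ Δ₀ : Vec d} {K N : ℕ} {D : ℝ} {η : ℕ → ℝ} {L : Vec d} {δ : ℝ}

/-- The stationarity measure at a block average, bounded through the uniform distribution on the
iterates of the block. -/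
theorem stationarity_blockAverage_le (hR : R.IsStoSignSGD μ f x₀ Δ₀ K N D η) (hD : 0 ≤ D)
    (hN : 1 ≤ N) (hδ : 0 ≤ δ) {j : ℕ} (hj : j < K) (ω : Ω) :
    stationarity 1 ∞ δ f (R.blockAverage x₀ N (j + 1) ω) ≤
      (N : ℝ)⁻¹ * vecNorm 1 (∑ n ∈ Finset.Icc 1 N, gradient f (R.iterate x₀ (j * N + n) ω)) +
      δ * (D ^ 2 * (N * ∑ m ∈ Finset.Icc 1 N, R.scale (j * N + m) ω ^ 2)) := by
  have hN0 : (0 : ℝ) < N := by exact_mod_cast hN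
  refine (stationarity_average_le (p := 1) (q := ∞) (f := f) hδ hN
    (fun n => R.iterate x₀ (j * N + n) ω) (x := R.blockAverage x₀ N (j + 1) ω)
    (by simp [blockAverage])).trans ?_
  refine add_le_add le_rfl (mul_le_mul_of_nonneg_left ?_ hδ)
  have hpt : ∀ n ∈ Finset.Icc 1 N,
      vecNorm ∞ (R.iterate x₀ (j * N + n) ω - R.blockAverage x₀ N (j + 1) ω) ^ 2 ≤
      D ^ 2 * (N * ∑ m ∈ Finset.Icc 1 N, R.scale (j * N + m) ω ^ 2) := by
    intro n hn
    rw [Finset.mem_Icc] at hn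
    calc _ ≤ (D * ∑ m ∈ Finset.Icc 1 N, |R.scale (j * N + m) ω|) ^ 2 :=
          pow_le_pow_left₀ (vecNorm_nonneg _ _)
            (hR.vecNorm_iterate_sub_blockAverage_le hD hj ω hn.1 hn.2) 2
      _ = D ^ 2 * (∑ m ∈ Finset.Icc 1 N, |R.scale (j * N + m) ω|) ^ 2 := mul_pow _ _ _
      _ ≤ _ := by
          have := sq_sum_le_card_mul_sum_sq (s := Finset.Icc 1 N)
            (f := fun m => |R.scale (j * N + m) ω|)
          simp only [Nat.card_Icc, Nat.add_sub_cancel, sq_abs] at this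
          gcongr
  have hs := Finset.sum_le_sum hpt
  rw [Finset.sum_const, Nat.card_Icc, Nat.add_sub_cancel, nsmul_eq_mul] at hs
  rw [inv_mul_le_iff₀ hN0]
  exact hs

/-- The expected stationarity measure of the output, for arbitrary parameters. -/
theorem integrable_and_integral_stationarity_le [IsProbabilityMeasure μ]
    (hR : R.IsStoSignSGD μ f x₀ Δ₀ K N D (stepSize D N)) (hf : WellBehaved f)
    (hbdd : BddBelow (Set.range f)) {Δf : ℝ} (hgap : f x₀ - ⨅ x, f x ≤ Δf)
    (hLip : R.CoordLipschitz μ (K * N) L) (hD : 0 < D) (hK : 1 ≤ K) (hN : 1 ≤ N) (hδ : 0 ≤ δ) :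
    Integrable (fun ω => stationarity 1 ∞ δ f (R.output x₀ N ω)) μ ∧
    ∫ ω, stationarity 1 ∞ δ f (R.output x₀ N ω) ∂μ ≤
      Δf / (K * (N * D)) + 6 * vecNorm 1 L / √N + 2 * δ * (N * D) ^ 2 := by
  have hK0 : (0 : ℝ) < K := by exact_mod_cast hK
  have hN0 : (0 : ℝ) < N := by exact_mod_cast hN
  set A : ℕ → Ω → ℝ := fun j ω =>
    vecNorm 1 (∑ n ∈ Finset.Icc 1 N, gradient f (R.iterate x₀ (j * N + n) ω)) with hA
  set B : ℕ → Ω → ℝ := fun j ω => ∑ m ∈ Finset.Icc 1 N, R.scale (j * N + m) ω ^ 2 with hB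
  set Φ : ℕ → Ω → ℝ := fun j ω => (N : ℝ)⁻¹ * A j ω + δ * (D ^ 2 * (N * B j ω)) with hΦ
  set S : ℕ → Ω → ℝ := fun k ω => stationarity 1 ∞ δ f (R.blockAverage x₀ N k ω) with hS
  have hpred : ∀ k ∈ Finset.Icc 1 K, k - 1 < K ∧ k - 1 + 1 = k := fun k hk => by
    rw [Finset.mem_Icc] at hk; omega
  have hle : R.history (K * N) ≤ (inferInstance : MeasurableSpace Ω) := hR.history_le le_rfl
  have hblock : ∀ j < K, ∀ n ∈ Finset.Icc 1 N, ∃ t, j * N + n = t + 1 ∧ t < K * N :=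
    fun j hj n hn => exists_round hj (Finset.mem_Icc.1 hn).1 (Finset.mem_Icc.1 hn).2
  -- measurability with respect to the history of all rounds
  have hiter : ∀ j < K, ∀ n ∈ Finset.Icc 1 N,
      Measurable[R.history (K * N)] (R.iterate x₀ (j * N + n)) := fun j hj n hn => by
    obtain ⟨t, ht, htT⟩ := hblock j hj n hn
    rw [ht]
    exact (R.measurable_iterate_history x₀ (t + 1)).mono (R.history_mono htT) le_rfl
  have hAm : ∀ j < K, Measurable[R.history (K * N)] (A j) := fun j hj =>
    (continuous_vecNorm 1).measurable.comp (Finset.measurable_fun_sum _ fun n hn =>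
      (measurable_gradient f).comp (hiter j hj n hn))
  have hBm : ∀ j < K, Measurable[R.history (K * N)] (B j) := fun j hj =>
    Finset.measurable_fun_sum _ fun n hn => by
      obtain ⟨t, ht, htT⟩ := hblock j hj n hn
      rw [ht]
      exact (show Measurable fun r : ℝ => r ^ 2 by fun_prop).comp (R.measurable_scale_history htT)
  have hΦm : ∀ j < K, Measurable[R.history (K * N)] (Φ j) := fun j hj =>
    (show Measurable fun p : ℝ × ℝ => (N : ℝ)⁻¹ * p.1 + δ * (D ^ 2 * (N * p.2)) by fun_prop).comp
      ((hAm j hj).prodMk (hBm j hj))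
  have hSm : ∀ k ∈ Finset.Icc 1 K, Measurable (S k) := fun k hk => by
    obtain ⟨hk1, -⟩ := hpred k hk
    have hb : Measurable fun ω => ∑ n ∈ Finset.Icc 1 N, R.iterate x₀ ((k - 1) * N + n) ω :=
      Finset.measurable_fun_sum _ fun n hn => (hiter (k - 1) hk1 n hn).mono hle le_rfl
    exact (measurable_stationarity hδ).comp (hb.const_smul ((N : ℝ)⁻¹))
  -- integrals of the bound
  have hAi : ∀ j < K, Integrable (A j) μ := fun j hj => hR.integrable_vecNorm_sum_gradient hj
  have hBi : ∀ j < K, Integrable (B j) μ ∧ ∫ ω, B j ω ∂μ = N * 2 := fun j hj => by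
    have hs : ∀ n ∈ Finset.Icc 1 N, Integrable (fun ω => R.scale (j * N + n) ω ^ 2) μ ∧
        ∫ ω, R.scale (j * N + n) ω ^ 2 ∂μ = 2 := fun n hn => by
      obtain ⟨t, ht, htT⟩ := hblock j hj n hn
      rw [ht]
      exact hR.integral_scale_sq htT
    refine ⟨integrable_finsetSum _ fun n hn => (hs n hn).1, ?_⟩
    rw [integral_finsetSum _ fun n hn => (hs n hn).1, Finset.sum_congr rfl fun n hn => (hs n hn).2]
    simp
  have hΦi : ∀ j < K, Integrable (Φ j) μ ∧
      ∫ ω, Φ j ω ∂μ = (N : ℝ)⁻¹ * ∫ ω, A j ω ∂μ + 2 * δ * (N * D) ^ 2 := fun j hj => by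
    have i1 := (hAi j hj).const_mul (N : ℝ)⁻¹
    have i2 := (((hBi j hj).1.const_mul (N : ℝ)).const_mul (D ^ 2)).const_mul δ
    refine ⟨i1.add i2, ?_⟩
    simp only [hΦ]
    rw [integral_add i1 i2, integral_const_mul, integral_const_mul, integral_const_mul,
      integral_const_mul, (hBi j hj).2]
    ring
  have hms : ∀ k, MeasurableSet (R.index ⁻¹' {k}) :=
    fun k => hR.index_measurable (measurableSet_singleton k)
  have hsel : ∀ (g : ℕ → Ω → ℝ) (ω : Ω), R.index ω ∈ Finset.Icc 1 K →
      ∑ k ∈ Finset.Icc 1 K, (R.index ⁻¹' {k}).indicator (g k) ω = g (R.index ω) ω := by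
    intro g ω hω
    rw [Finset.sum_eq_single_of_mem _ hω fun k _ hk => ?_]
    · simp
    · rw [Set.indicator_of_notMem]
      exact fun h => hk (Set.mem_singleton_iff.1 h).symm
  have hind := ae_mem_of_uniform hR.index_measurable hR.index_law
  -- the bound of the block selected by the index
  set Ψ : Ω → ℝ := fun ω => ∑ k ∈ Finset.Icc 1 K, (R.index ⁻¹' {k}).indicator (Φ (k - 1)) ω
    with hΨ
  have hΨi : Integrable Ψ μ := integrable_finsetSum _ fun k hk =>
    (hΦi (k - 1) (hpred k hk).1).1.indicator (hms k)
  have hbound : ∀ᵐ ω ∂μ, stationarity 1 ∞ δ f (R.output x₀ N ω) ≤ Ψ ω := by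
    filter_upwards [hind] with ω hω
    obtain ⟨h1, h2⟩ := hpred _ hω
    have := hR.stationarity_blockAverage_le hD.le hN hδ h1 ω
    rw [h2] at this
    exact this.trans (hsel (fun k => Φ (k - 1)) ω hω).ge
  have hmeas : AEStronglyMeasurable (fun ω => stationarity 1 ∞ δ f (R.output x₀ N ω)) μ := by
    have h1 : Measurable fun ω =>
        ∑ k ∈ Finset.Icc 1 K, (R.index ⁻¹' {k}).indicator (S k) ω :=
      Finset.measurable_fun_sum _ fun k hk => (hSm k hk).indicator (hms k)
    refine h1.aestronglyMeasurable.congr ?_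
    filter_upwards [hind] with ω hω
    exact hsel S ω hω
  have hint : Integrable (fun ω => stationarity 1 ∞ δ f (R.output x₀ N ω)) μ := by
    refine hΨi.mono' hmeas ?_
    filter_upwards [hbound] with ω hω
    rwa [Real.norm_of_nonneg (stationarity_nonneg hδ _)]
  refine ⟨hint, (integral_mono_ae hint hΨi hbound).trans ?_⟩
  rw [hΨ, integral_sum_indicator_uniform hle hR.index_measurable hR.index_law hR.index_indep
    (fun k hk => hΦm _ (hpred k hk).1) (fun k hk => (hΦi _ (hpred k hk).1).1)]
  have hsum : ∑ k ∈ Finset.Icc 1 K, ∫ ω, Φ (k - 1) ω ∂μ = ∑ j ∈ Finset.range K, ∫ ω, Φ j ω ∂μ := by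
    rw [Finset.range_eq_Ico, Finset.sum_Ico_eq_sum_range, ← Finset.Ico_add_one_right_eq_Icc,
      Finset.sum_Ico_eq_sum_range]
    simp [add_comm]
  rw [hsum, Finset.sum_congr rfl fun j hj => (hΦi j (Finset.mem_range.1 hj)).2,
    Finset.sum_add_distrib, ← Finset.mul_sum, Finset.sum_const, Finset.card_range, nsmul_eq_mul]
  have hmain := hR.sum_integral_vecNorm_le hf hbdd hgap hLip hD hN
  rw [mul_comm D, ← le_div_iff₀ hD] at hmain
  have hsq : √(N : ℝ) * √(N : ℝ) = N := Real.mul_self_sqrt hN0.le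
  have hsq0 : 0 < √(N : ℝ) := Real.sqrt_pos.2 hN0
  calc (K : ℝ)⁻¹ * ((N : ℝ)⁻¹ * ∑ j ∈ Finset.range K, ∫ ω, A j ω ∂μ +
        K * (2 * δ * (N * D) ^ 2))
      ≤ (K : ℝ)⁻¹ * ((N : ℝ)⁻¹ * ((Δf + K * (6 * D * √N * vecNorm 1 L)) / D) +
        K * (2 * δ * (N * D) ^ 2)) := by gcongr
    _ = Δf / (K * (N * D)) + 6 * vecNorm 1 L * (√N / N) + 2 * δ * (N * D) ^ 2 := by
        field_simp
    _ = _ := by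
        have : √(N : ℝ) / N = 1 / √N := by
          rw [div_eq_div_iff hN0.ne' hsq0.ne', one_mul, hsq]
        rw [this]; ring

end Trace.IsStoSignSGD

/-! ### The choice of parameters -/

section Parameters

variable {Δf δ ε : ℝ}

theorem preK_pos (hΔf : 0 < Δf) (hδ : 0 < δ) (hε : 0 < ε) : 0 < preK Δf δ ε := by
  unfold preK; positivity

theorem preN_pos {d : ℕ} {L : Vec d} (hL : 0 < vecNorm 1 L) (hε : 0 < ε) : 0 < preN L ε := by
  unfold preN; positivity

/-- The three contributions to the stationarity measure are at most `2ε/7`, `2ε/9` and `ε/7`. -/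
theorem parameter_bound {ℓ K N D : ℝ} (hΔf : 0 < Δf) (hδ : 0 < δ) (hε : 0 < ε)
    (hK : preK Δf δ ε ≤ K) (hN : 751 * ℓ ^ 2 * ε ^ (-2 : ℝ) ≤ N) (hN0 : 0 < N)
    (hD : D = √ε / (√(14 * δ) * N)) :
    Δf / (K * (N * D)) + 6 * ℓ / √N + 2 * δ * (N * D) ^ 2 ≤ ε := by
  have hK0 : 0 < K := (preK_pos hΔf hδ hε).trans_le hK
  have hsε : 0 < √ε := Real.sqrt_pos.2 hε
  have hsδ : 0 < √δ := Real.sqrt_pos.2 hδ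
  have hs14 : 0 < √(14 : ℝ) := Real.sqrt_pos.2 (by norm_num)
  have hsε2 : √ε ^ 2 = ε := Real.sq_sqrt hε.le
  have hsδ2 : √δ ^ 2 = δ := Real.sq_sqrt hδ.le
  have hs142 : √(14 : ℝ) ^ 2 = 14 := Real.sq_sqrt (by norm_num)
  have hND : N * D = √ε / (√14 * √δ) := by
    rw [hD, Real.sqrt_mul (by norm_num)]; field_simp
  have e32 : ε ^ (3 / 2 : ℝ) = ε * √ε := by
    rw [Real.sqrt_eq_rpow, show (3 / 2 : ℝ) = 1 + 1 / 2 by norm_num, Real.rpow_add hε,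
      Real.rpow_one]
  have h1 : Δf / (K * (N * D)) ≤ 2 * ε / 7 := by
    rw [preK, ← Real.sqrt_eq_rpow, e32, div_le_iff₀ (by positivity)] at hK
    rw [hND, div_le_iff₀ (by positivity), ← mul_div_assoc, ← mul_div_assoc,
      le_div_iff₀ (by positivity)]
    linarith
  have h2 : 6 * ℓ / √N ≤ 2 * ε / 9 := by
    -- `27 ^ 2 = 729 ≤ 751`
    have h3 : 27 * ℓ / ε ≤ √N := by
      refine Real.le_sqrt_of_sq_le (le_trans ?_ hN)
      have e2 : ε ^ (-2 : ℝ) = (ε ^ 2)⁻¹ := by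
        rw [Real.rpow_neg hε.le]; norm_num
      rw [e2, div_pow, div_eq_mul_inv]
      gcongr
      nlinarith [sq_nonneg ℓ]
    rw [div_le_iff₀ hε] at h3
    rw [div_le_iff₀ (Real.sqrt_pos.2 hN0)]
    linarith
  have h3 : 2 * δ * (N * D) ^ 2 = ε / 7 := by
    rw [hND, div_pow, mul_pow, hsε2, hsδ2, hs142]
    field_simp
    norm_num
  linarith

theorem natCeil_le_two_mul {a : ℝ} (ha : 1 / 2 ≤ a) : (⌈a⌉₊ : ℝ) ≤ 2 * a := by
  rcases le_or_gt a 1 with h | h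
  · have : ⌈a⌉₊ ≤ 1 := Nat.ceil_le.2 (by simpa using h)
    have : (⌈a⌉₊ : ℝ) ≤ 1 := by exact_mod_cast this
    linarith
  · have := Nat.ceil_lt_add_one (show 0 ≤ a by linarith)
    linarith

theorem natCeil_le_three_halves_mul {a : ℝ} (ha : 0 ≤ a) (h : 3 ≤ ⌈a⌉₊) :
    (⌈a⌉₊ : ℝ) ≤ 3 / 2 * a := by
  have h1 := Nat.ceil_lt_add_one ha
  have h2 : (2 : ℝ) < a := by
    have := Nat.lt_ceil.1 (show 2 < ⌈a⌉₊ by omega)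
    exact_mod_cast this
  linarith

theorem four_mul_preK_mul_preN_le {d : ℕ} {L : Vec d} (hΔf : 0 < Δf) (hδ : 0 < δ) (hε : 0 < ε) :
    4 * (preK Δf δ ε * preN L ε) ≤
      39340 * Δf * vecNorm 1 L ^ 2 * δ ^ (1 / 2 : ℝ) * ε ^ (-(7 / 2) : ℝ) := by
  have hp : ε ^ (-(7 / 2) : ℝ) = (ε ^ (3 / 2 : ℝ))⁻¹ * ε ^ (-2 : ℝ) := by
    rw [← Real.rpow_neg hε.le, ← Real.rpow_add hε]; norm_num
  have h14 : √(14 : ℝ) ≤ 39340 / 10514 := by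
    rw [Real.sqrt_le_left (by norm_num)]; norm_num
  have e : 4 * (preK Δf δ ε * preN L ε) = (10514 * √14) *
      (Δf * vecNorm 1 L ^ 2 * δ ^ (1 / 2 : ℝ) * ((ε ^ (3 / 2 : ℝ))⁻¹ * ε ^ (-2 : ℝ))) := by
    -- `4 * (7 / 2) * 751 = 10514`
    rw [preK, preN]; field_simp; ring
  rw [e, hp]
  calc _ ≤ 39340 *
      (Δf * vecNorm 1 L ^ 2 * δ ^ (1 / 2 : ℝ) * ((ε ^ (3 / 2 : ℝ))⁻¹ * ε ^ (-2 : ℝ))) := by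
        gcongr
        linarith
    _ = _ := by ring

end Parameters

end StoSign

theorem mainTheorem2
    {d : ℕ} {Ω : Type*} [MeasurableSpace Ω] (μ : MeasureTheory.Measure Ω)
    [MeasureTheory.IsProbabilityMeasure μ]
    (f : StoSign.Vec d → ℝ) (hf : StoSign.WellBehaved f) (hbdd : BddBelow (Set.range f))
    (x₀ : StoSign.Vec d) (Δf : ℝ) (hΔf : 0 < Δf) (hgap : f x₀ - ⨅ x, f x ≤ Δf)
    (δ ε : ℝ) (hδ : 0 < δ) (hε : 0 < ε)
    (L : StoSign.Vec d) (hL : 0 < StoSign.vecNorm 1 L)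
    (K N : ℕ) (hK : K = StoSign.numBlocks Δf δ ε) (hN : N = StoSign.blockLength L ε)
    (D : ℝ) (hD : D = StoSign.radius δ ε N)
    (Δ₀ : StoSign.Vec d) (hΔ₀ : Δ₀ ∈ StoSign.lqBall ∞ 0 D)
    (R : StoSign.Trace d Ω)
    (hR : R.IsStoSignSGD μ f x₀ Δ₀ K N D (StoSign.stepSize D N))
    (hLip : R.CoordLipschitz μ (K * N) L) :
    (Integrable (fun ω => StoSign.stationarity 1 ∞ δ f (R.output x₀ N ω)) μ ∧
      ∫ ω, StoSign.stationarity 1 ∞ δ f (R.output x₀ N ω) ∂μ ≤ ε) ∧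
    (1 / 2 ≤ StoSign.preK Δf δ ε → 1 / 2 ≤ StoSign.preN L ε →
      ((K * N : ℕ) : ℝ) ≤
          39340 * Δf * StoSign.vecNorm 1 L ^ 2 * δ ^ (1 / 2 : ℝ) * ε ^ (-(7 / 2) : ℝ) ∧
      (3 ≤ K ∨ 3 ≤ N →
        ((K * N : ℕ) : ℝ) ≤
          39326 * Δf * StoSign.vecNorm 1 L ^ 2 * δ ^ (1 / 2 : ℝ) * ε ^ (-(7 / 2) : ℝ))) := by
  have hK1 : 1 ≤ K := hK ▸ Nat.ceil_pos.2 (StoSign.preK_pos hΔf hδ hε)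
  have hN1 : 1 ≤ N := hN ▸ Nat.ceil_pos.2 (StoSign.preN_pos hL hε)
  have hN0 : (0 : ℝ) < N := by exact_mod_cast hN1
  have hD0 : 0 < D := by
    rw [hD, StoSign.radius]; positivity
  constructor
  · obtain ⟨h1, h2⟩ := hR.integrable_and_integral_stationarity_le hf hbdd hgap hLip hD0 hK1 hN1
      hδ.le
    refine ⟨h1, h2.trans (StoSign.parameter_bound hΔf hδ hε ?_ ?_ hN0 hD)⟩
    · rw [hK]; exact Nat.le_ceil _
    · rw [hN]; exact Nat.le_ceil _
  · intro ha hb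
    have hfour := StoSign.four_mul_preK_mul_preN_le (L := L) hΔf hδ hε
    have hKa : (K : ℝ) ≤ 2 * StoSign.preK Δf δ ε := hK ▸ StoSign.natCeil_le_two_mul ha
    have hNb : (N : ℝ) ≤ 2 * StoSign.preN L ε := hN ▸ StoSign.natCeil_le_two_mul hb
    push_cast
    refine ⟨?_, fun h3 => ?_⟩
    · refine le_trans ?_ hfour
      calc (K : ℝ) * N ≤ (2 * StoSign.preK Δf δ ε) * (2 * StoSign.preN L ε) := by gcongr
        _ = _ := by ring
    · have hthree : (K : ℝ) * N ≤ 3 * (StoSign.preK Δf δ ε * StoSign.preN L ε) := by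
        rcases h3 with h3 | h3
        · have h4 : (K : ℝ) ≤ 3 / 2 * StoSign.preK Δf δ ε := by
            rw [hK] at h3 ⊢
            exact StoSign.natCeil_le_three_halves_mul (by linarith) h3
          calc (K : ℝ) * N ≤ (3 / 2 * StoSign.preK Δf δ ε) * (2 * StoSign.preN L ε) := by gcongr
            _ = _ := by ring
        · have h4 : (N : ℝ) ≤ 3 / 2 * StoSign.preN L ε := by
            rw [hN] at h3 ⊢
            exact StoSign.natCeil_le_three_halves_mul (by linarith) h3
          calc (K : ℝ) * N ≤ (2 * StoSign.preK Δf δ ε) * (3 / 2 * StoSign.preN L ε) := by gcongr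
            _ = _ := by ring
      have hpos : 0 ≤ Δf * StoSign.vecNorm 1 L ^ 2 * δ ^ (1 / 2 : ℝ) * ε ^ (-(7 / 2) : ℝ) := by
        positivity
      linarith
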